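/- Let $1\le N_t\le N_r$ be integers, let $\mathbf F\in\mathbb C^{N_t\times N_t}$ be invertible, let $\boldsymbol\Sigma\in\mathbb C^{N_t\times N_t}$ be Hermitian positive definite, let $\sigma>0$ and $\eta=1/\sigma^2$. Consider the model $\mathbf r=\mathbf H\mathbf F\mathbf s+\boldsymbol\xi$, where: - the $N_r\times N_t$ channel matrix $\mathbf H$, with entries $h_{mn}$, is circularly-symmetric complex Gaussian with mean zero and covariance $\mathbf I\otimes\boldsymbol\Sigma$, that is, $\mathbb E[\overline{h_{\ell a}}\,h_{mb}]=\delta_{\ell m}\Sigma_{ab}$; - the noise $\boldsymbol\xi\in\mathbb C^{N_r}$ is circularly-symmetric complex Gaussian with mean zero and covariance $\sigma^2\mathbf I$; - the symbols $s_1,\dots,s_{N_t}$ are independent and uniformly distributed on a constellation $\mathcal S\subset\mathbb C$; - $\mathbf H$, $\boldsymbol\xi$ and $\mathbf s$ are mutually independent. The zero-forcing detector forms $\mathbf r'=(\mathbf H\mathbf F)^{+}\mathbf r$ with $(\mathbf H\mathbf F)^{+}=(\mathbf F^H\mathbf H^H\mathbf H\mathbf F)^{-1}\mathbf F^H\mathbf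 H^H$ and decides for some $\hat s_k\in\arg\min_{a\in\mathcal S}|r'_k-a|^2$, ties being broken arbitrarily. The average symbol error probability is $P(\mathbf F)=\frac1{N_t}\sum_{k=1}^{N_t}\Pr(\hat s_k\ne s_k)$, where the probability is over the channel, the noise and the symbols. Then, in each of the three cases below, $$P(\mathbf F)=\frac1{N_t}\sum_{k=1}^{N_t}G\big([(\mathbf F^H\boldsymbol\Sigma\mathbf F)^{-1}]_{kk}\big),$$ and $G$ is convex on the interval $0<x\le T$. Write $D=N_r-N_t+1$. 1. $M$-ary PAM, $M\ge2$, $\mathcal S=\{(2p+1-M)\sqrt{3/(M^2-1)}:p\in\{0,\dots,M-1\}\}$: $$G(x)=\frac{2(M-1)}{M\pi}\int_0^{\pi/2}\Big(1+\frac{3\eta}{(M^2-1)x\sin^2\theta}\Big)^{-D}d\theta,\qquad T=\frac{3\eta(N_r-N_t)}{2(M^2-1)}.$$ 2. $M$-ary PSK, $M\ge2$, $\mathcal S=\{e^{2\pi\mathrm i\,p/M}:p\in\{0,\dots,M-1\}\}$ (with $\mathrm i$ the imaginary unit): $$G(x)=\frac1\pi\int_0^{(M-1)\pi/M}\Big(1+\frac{\eta\sin^2(\pi/M)}{x\sin^2\theta}\Big)^{-D}d\theta,\qquad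 T=\frac{\eta(N_r-N_t)\sin^2(\pi/M)}{2}.$$ 3. Square $M$-ary QAM, $M=L^2$ with $L\ge2$, $\mathcal S=\{((2p+1-L)+\mathrm i(2q+1-L))\sqrt{3/(2(M-1))}:p,q\in\{0,\dots,L-1\}\}$: $$G(x)=\frac{4(\sqrt M-1)}{\sqrt M\,\pi}\int_{\pi/4}^{\pi/2}\Big(1+\frac{3\eta}{2(M-1)x\sin^2\theta}\Big)^{-D}d\theta+\frac{4(\sqrt M-1)}{M\pi}\int_0^{\pi/4}\Big(1+\frac{3\eta}{2(M-1)x\sin^2\theta}\Big)^{-D}d\theta,$$ $$T=\frac{3\eta(N_r-N_t)}{4(M-1)}.$$ -/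

import Mathlib

open MeasureTheory ProbabilityTheory
open scoped Matrix Kronecker ComplexConjugate ComplexOrder

noncomputable section

/-- The random vector `X` is circularly-symmetric (proper) complex Gaussian with mean zero and
covariance matrix `C`: its real and imaginary parts are jointly Gaussian, and
`E[X_i] = 0`, `E[conj X_i * X_j] = C i j`, `E[X_i * X_j] = 0`. -/
structure IsComplexGaussian {Ω ι : Type*} [MeasurableSpace Ω] [Fintype ι]
    (μ : Measure Ω) (X : Ω → ι → ℂ) (C : Matrix ι ι ℂ) : Prop where
  gaussian : HasGaussianLaw X μ
  mean : ∀ i, ∫ ω, X ω i ∂μ = 0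
  covariance : ∀ i j, ∫ ω, conj (X ω i) * X ω j ∂μ = C i j
  pseudocovariance : ∀ i j, ∫ ω, X ω i * X ω j ∂μ = 0

/-- The pseudo-inverse `(Aᴴ A)⁻¹ Aᴴ` of a matrix of full column rank. -/
def pseudoInverse {m n : ℕ} (A : Matrix (Fin m) (Fin n) ℂ) : Matrix (Fin n) (Fin m) ℂ :=
  (Aᴴ * A)⁻¹ * Aᴴ

/-- The received vector `r = H F s + ξ`. -/
def receivedSignal {Nr Nt : ℕ} (F : Matrix (Fin Nt) (Fin Nt) ℂ)
    (H : Matrix (Fin Nr) (Fin Nt) ℂ) (s : Fin Nt → ℂ) (ξ : Fin Nr → ℂ) : Fin Nr → ℂ :=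
  (H * F) *ᵥ s + ξ

/-- The zero-forcing equalized vector `r' = (H F)⁺ r`. -/
def zfEqualize {Nr Nt : ℕ} (F : Matrix (Fin Nt) (Fin Nt) ℂ)
    (H : Matrix (Fin Nr) (Fin Nt) ℂ) (r : Fin Nr → ℂ) : Fin Nt → ℂ :=
  pseudoInverse (H * F) *ᵥ r

/-- `a` is a hard decision for `z` in the constellation `S`: it minimizes `|z - a|²` over `S`
(ties may be broken in any way). -/
def IsHardDecision (S : Set ℂ) (z a : ℂ) : Prop :=
  a ∈ S ∧ ∀ b ∈ S, ‖z - a‖ ^ 2 ≤ ‖z - b‖ ^ 2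

/-- The precoded transmission model with constellation `S`, precoder `F`, transmit covariance
`Sig`, noise variance `σ ^ 2`, random channel `H`, noise `ξ`, symbols `s`, and decisions `sHat`
of the zero-forcing detector. -/
structure IsZFSystem {Ω : Type*} [MeasurableSpace Ω] (μ : Measure Ω) {Nr Nt : ℕ} (S : Set ℂ)
    (F Sig : Matrix (Fin Nt) (Fin Nt) ℂ) (σ : ℝ)
    (H : Ω → Matrix (Fin Nr) (Fin Nt) ℂ) (ξ : Ω → Fin Nr → ℂ)
    (s sHat : Ω → Fin Nt → ℂ) : Prop where
  /-- The rows of the channel are independent with covariance `Sig`. -/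
  channel : IsComplexGaussian μ (fun ω (p : Fin Nr × Fin Nt) => H ω p.1 p.2)
    ((1 : Matrix (Fin Nr) (Fin Nr) ℂ) ⊗ₖ Sig)
  noise : IsComplexGaussian μ ξ ((((σ ^ 2 : ℝ) : ℂ)) • (1 : Matrix (Fin Nr) (Fin Nr) ℂ))
  /-- Every symbol is equally likely to be any point of the constellation. -/
  symbols_uniform : ∀ k, HasLaw (fun ω => s ω k) (uniformOn S) μ
  symbols_indep : iIndepFun (fun k ω => s ω k) μ
  /-- Channel, noise and symbols are mutually independent (together with the next field). -/
  channel_indep_noise :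
    IndepFun (fun ω (p : Fin Nr × Fin Nt) => H ω p.1 p.2) ξ μ
  symbols_indep_channel_noise :
    IndepFun (fun ω => ((fun p : Fin Nr × Fin Nt => H ω p.1 p.2), ξ ω)) s μ
  detection : ∀ ω k,
    IsHardDecision S (zfEqualize F (H ω) (receivedSignal F (H ω) (s ω) (ξ ω)) k) (sHat ω k)

/-- The average symbol error probability: the arithmetic mean over the streams `k` of the
probability (over channel, noise and symbols) that the decision differs from the symbol. -/
def averageSEP {Ω : Type*} [MeasurableSpace Ω] (μ : Measure Ω) {Nt : ℕ}
    (s sHat : Ω → Fin Nt → ℂ) : ℝ :=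
  (1 / (Nt : ℝ)) * ∑ k, μ.real {ω | sHat ω k ≠ s ω k}

/-- `M`-ary PAM with unit average energy: the equally spaced real points `(2 i + 1 - M) d`,
`0 ≤ i < M`, with `d = √(3 / (M² - 1))`. -/
def pamConstellation (M : ℕ) : Set ℂ :=
  Set.range fun i : Fin M =>
    (((2 * (i : ℝ) + 1 - M) * √(3 / ((M : ℝ) ^ 2 - 1)) : ℝ) : ℂ)

/-- `M`-ary PSK: the `M`-th roots of unity. -/
def pskConstellation (M : ℕ) : Set ℂ :=
  Set.range fun i : Fin M => Complex.exp (2 * Real.pi * Complex.I * (i : ℕ) / M)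

/-- Square QAM with `M = L²` points and unit average energy: the points
`(2 i + 1 - L) d + (2 j + 1 - L) d I`, `0 ≤ i, j < L`, with `d = √(3 / (2 (M - 1)))`. -/
def qamConstellation (L : ℕ) : Set ℂ :=
  Set.range fun p : Fin L × Fin L =>
    (⟨(2 * (p.1 : ℝ) + 1 - L) * √(3 / (2 * ((L : ℝ) ^ 2 - 1))),
      (2 * (p.2 : ℝ) + 1 - L) * √(3 / (2 * ((L : ℝ) ^ 2 - 1)))⟩ : ℂ)

/-- The function `θ ↦ (1 + c / (x sin² θ)) ^ (-(Nr - Nt + 1))`. -/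
def craigIntegrand (Nr Nt : ℕ) (c x θ : ℝ) : ℝ :=
  (1 + c / (x * Real.sin θ ^ 2)) ^ (-((Nr : ℤ) - (Nt : ℤ) + 1))

def pamG (Nr Nt M : ℕ) (η x : ℝ) : ℝ :=
  2 * ((M : ℝ) - 1) / (M * Real.pi) *
    ∫ θ in (0 : ℝ)..(Real.pi / 2), craigIntegrand Nr Nt (3 * η / ((M : ℝ) ^ 2 - 1)) x θ

def pskG (Nr Nt M : ℕ) (η x : ℝ) : ℝ :=
  1 / Real.pi *
    ∫ θ in (0 : ℝ)..(((M : ℝ) - 1) * Real.pi / M),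
      craigIntegrand Nr Nt (η * Real.sin (Real.pi / M) ^ 2) x θ

def qamG (Nr Nt M : ℕ) (η x : ℝ) : ℝ :=
  4 * (√(M : ℝ) - 1) / (√(M : ℝ) * Real.pi) *
      (∫ θ in (Real.pi / 4)..(Real.pi / 2),
        craigIntegrand Nr Nt (3 * η / (2 * ((M : ℝ) - 1))) x θ) +
    4 * (√(M : ℝ) - 1) / (M * Real.pi) *
      (∫ θ in (0 : ℝ)..(Real.pi / 4),
        craigIntegrand Nr Nt (3 * η / (2 * ((M : ℝ) - 1))) x θ)

def pamThreshold (Nr Nt M : ℕ) (η : ℝ) : ℝ :=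
  3 * η * ((Nr : ℝ) - Nt) / (2 * ((M : ℝ) ^ 2 - 1))

def pskThreshold (Nr Nt M : ℕ) (η : ℝ) : ℝ :=
  η * ((Nr : ℝ) - Nt) * Real.sin (Real.pi / M) ^ 2 / 2

def qamThreshold (Nr Nt M : ℕ) (η : ℝ) : ℝ :=
  3 * η * ((Nr : ℝ) - Nt) / (4 * ((M : ℝ) - 1))

end

/-! Zero forcing turns stream `k` into `s_k + Z`, where `Z` is the `k`-th row of `(HF)⁺` applied to
`ξ`. Given the channel, `Z` is circular Gaussian with variance `r² = σ² g`, where `g` is the `k`-th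
diagonal entry of `((HF)ᴴHF)⁻¹`. So `Z` is a Gaussian scale mixture, and everything depends on the
law of `r`.

Only the Laplace transform of `1 / g` is needed, not its density. The diagonal entry of an inverse
Gram matrix is the inverse squared distance of column `k` to the span of the other columns. For
independent standard Gaussian columns that squared distance is the squared norm of a Gaussian vector
projected onto a space of dimension `D = Nr - Nt + 1`, with Laplace transform `(1 + t)⁻ᴰ`. A
whitening whose `k`-th row is a multiple of `e_k` reduces the correlated case to this one and
rescales the entry by `x = [(FᴴΣF)⁻¹]ₖₖ` (`channel_gram_inv`, `exists_hasLaw_zf_noise`).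

The error event is that `Z` lies in an explicit region around the sent symbol
(`exists_symbolErrorProb_eq`). By symmetry it reduces to half-planes, quadrants and sectors, each of
the form `d < |z| h(arg z)`. In polar coordinates the radial Gaussian integral over such a region is
elementary and leaves `exp(-d² / (h² r²))` under an angular integral (Craig's formula). Averaging
over `r` replaces this exponential by the Laplace transform, which yields the integrand of `G`
(`scaleMixture_starRegion`).

Convexity is pointwise in `θ`: the integrand is `(x / (x + a))ᴰ` with `a = c / sin² θ ≥ c`, and its
second derivative has the sign of `(D - 1) a - 2 x` (`convexOn_div_add_pow`). -/

/-! ### Circular complex Gaussian vectors and their laws. -/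

section ComplexGaussian

/-- The law of a standard circularly-symmetric complex Gaussian variable. -/
noncomputable def stdComplexGaussian : Measure ℂ :=
  ((gaussianReal 0 (1 / 2)).prod (gaussianReal 0 (1 / 2))).map Complex.measurableEquivRealProd.symm

instance : IsProbabilityMeasure stdComplexGaussian :=
  Measure.isProbabilityMeasure_map Complex.measurableEquivRealProd.symm.measurable.aemeasurable

/-- Variance `1 / 2` in each real coordinate makes the density a function of `‖z‖` alone. Both the
isometry invariance and the polar computation of star-shaped regions rest on this. -/
lemma stdComplexGaussian_eq_withDensity :
    stdComplexGaussian =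
      volume.withDensity fun z : ℂ => ENNReal.ofReal (Real.pi⁻¹ * Real.exp (-‖z‖ ^ 2)) := by
  have h : (1 / 2 : NNReal) ≠ 0 := by norm_num
  refine Measure.ext fun s hs => ?_
  rw [stdComplexGaussian, Measure.map_apply (by fun_prop) hs, gaussianReal_of_var_ne_zero _ h,
    prod_withDensity (measurable_gaussianPDF _ _) (measurable_gaussianPDF _ _),
    withDensity_apply _ (Complex.measurableEquivRealProd.symm.measurable hs),
    withDensity_apply _ hs,
    ← (Complex.volume_preserving_equiv_real_prod.symm).setLIntegral_comp_preimage hs (by fun_prop)]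
  refine lintegral_congr fun p => ?_
  rw [gaussianPDF, gaussianPDF, ← ENNReal.ofReal_mul (gaussianPDFReal_nonneg _ _ _)]
  congr 1
  have h2 : ‖Complex.measurableEquivRealProd.symm p‖ ^ 2 = p.1 ^ 2 + p.2 ^ 2 := by
    rw [Complex.sq_norm, Complex.normSq_apply]
    simp [Complex.measurableEquivRealProd]
    ring
  have h3 : √(2 * Real.pi * ((1 / 2 : NNReal) : ℝ)) = √Real.pi := by
    congr 1; push_cast; ring
  rw [h2, gaussianPDFReal, gaussianPDFReal, h3, mul_mul_mul_comm, ← Real.exp_add, ← mul_inv,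
    Real.mul_self_sqrt Real.pi_pos.le]
  push_cast
  ring_nf

lemma stdComplexGaussian_absolutelyContinuous : stdComplexGaussian ≪ volume := by
  rw [stdComplexGaussian_eq_withDensity]
  exact withDensity_absolutelyContinuous _ _

lemma stdComplexGaussian_map_isometry (e : ℂ ≃ₗᵢ[ℝ] ℂ) :
    stdComplexGaussian.map e = stdComplexGaussian := by
  refine Measure.ext fun s hs => ?_
  have he := e.measurePreserving
  rw [Measure.map_apply e.continuous.measurable hs, stdComplexGaussian_eq_withDensity,
    withDensity_apply _ hs, withDensity_apply _ (e.continuous.measurable hs),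
    ← he.setLIntegral_comp_preimage hs (by fun_prop)]
  simp

variable {Ω ι κ : Type*} [MeasurableSpace Ω] [Fintype ι] [Fintype κ] {μ : Measure Ω}

lemma IsComplexGaussian.memLp {X : Ω → ι → ℂ} {C : Matrix ι ι ℂ} (hX : IsComplexGaussian μ X C)
    (i : ι) : MemLp (fun ω => X ω i) 2 μ :=
  (hX.gaussian.eval i).memLp_two

/-- The convention `E[conj X_i * X_j]` puts the conjugate on the left factor, hence `conj A * C *
Aᵀ` rather than `A * C * Aᴴ`. -/
lemma IsComplexGaussian.mulVec {X : Ω → ι → ℂ} {C : Matrix ι ι ℂ} (hX : IsComplexGaussian μ X C)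
    (A : Matrix κ ι ℂ) :
    IsComplexGaussian μ (fun ω => A *ᵥ X ω) (A.map conj * C * Aᵀ) where
  gaussian := by
    let L : (ι → ℂ) →L[ℝ] (κ → ℂ) := ((Matrix.mulVecLin A).restrictScalars ℝ).toContinuousLinearMap
    exact hX.gaussian.map_fun L
  mean i := by
    simp only [Matrix.mulVec, dotProduct]
    rw [integral_finsetSum _ fun j _ => ((hX.gaussian.eval j).integrable).const_mul _]
    simp [integral_const_mul, hX.mean]
  covariance i j := by
    have hint : ∀ a b, Integrable (fun ω => conj (A i a * X ω a) * (A j b * X ω b)) μ := by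
      intro a b
      refine MemLp.integrable_mul (p := 2) (q := 2) ?_ ((hX.memLp b).const_mul _)
      exact ((hX.memLp a).const_mul _).star
    simp only [Matrix.mulVec, dotProduct, map_sum, Finset.sum_mul_sum]
    rw [integral_finsetSum _ fun a _ => integrable_finsetSum _ fun b _ => hint a b]
    simp_rw [integral_finsetSum _ fun b _ => hint _ b]
    simp only [Matrix.mul_apply, Matrix.map_apply, Matrix.transpose_apply, Finset.sum_mul]
    rw [Finset.sum_comm]
    refine Finset.sum_congr rfl fun a _ => Finset.sum_congr rfl fun b _ => ?_
    rw [← hX.covariance, ← integral_const_mul, ← integral_mul_const]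
    refine integral_congr_ae (.of_forall fun ω => ?_)
    simp only [map_mul]; ring
  pseudocovariance i j := by
    have hint : ∀ a b, Integrable (fun ω => (A i a * X ω a) * (A j b * X ω b)) μ := by
      intro a b
      exact MemLp.integrable_mul (p := 2) (q := 2) ((hX.memLp a).const_mul _)
        ((hX.memLp b).const_mul _)
    simp only [Matrix.mulVec, dotProduct, Finset.sum_mul_sum]
    rw [integral_finsetSum _ fun a _ => integrable_finsetSum _ fun b _ => hint a b]
    simp_rw [integral_finsetSum _ fun b _ => hint _ b]
    refine Finset.sum_eq_zero fun a _ => Finset.sum_eq_zero fun b _ => ?_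
    have : ∀ ω, A i a * X ω a * (A j b * X ω b) = A i a * A j b * (X ω a * X ω b) :=
      fun ω => mul_mul_mul_comm _ _ _ _
    simp_rw [this, integral_const_mul, hX.pseudocovariance, mul_zero]

/-- The real and imaginary parts of the covariance and pseudocovariance identities form a linear
system in the four real second moments; the sums and differences solve it. -/
lemma IsComplexGaussian.integral_re_im {X : Ω → ι → ℂ} {C : Matrix ι ι ℂ}
    (hX : IsComplexGaussian μ X C) (i j : ι) :
    ∫ ω, (X ω i).re * (X ω j).re ∂μ = (C i j).re / 2 ∧
    ∫ ω, (X ω i).im * (X ω j).im ∂μ = (C i j).re / 2 ∧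
    ∫ ω, (X ω i).re * (X ω j).im ∂μ = (C i j).im / 2 := by
  have hi := hX.memLp i
  have hj := hX.memLp j
  have rr := hi.re.integrable_mul hj.re
  have ii := hi.im.integrable_mul hj.im
  have ri := hi.re.integrable_mul hj.im
  have ir := hi.im.integrable_mul hj.re
  have hc : Integrable (fun ω => conj (X ω i) * X ω j) μ := hi.star.integrable_mul hj
  have hp : Integrable (fun ω => X ω i * X ω j) μ := hi.integrable_mul hj
  have e1 := congrArg Complex.re (hX.covariance i j)
  have e2 := congrArg Complex.im (hX.covariance i j)
  have e3 := congrArg Complex.re (hX.pseudocovariance i j)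
  have e4 := congrArg Complex.im (hX.pseudocovariance i j)
  rw [← RCLike.re_eq_complex_re, ← integral_re hc] at e1
  rw [← RCLike.im_eq_complex_im, ← integral_im hc] at e2
  rw [← RCLike.re_eq_complex_re, ← integral_re hp] at e3
  rw [← RCLike.im_eq_complex_im, ← integral_im hp] at e4
  simp only [RCLike.re_eq_complex_re, RCLike.im_eq_complex_im, Complex.mul_re, Complex.mul_im,
    Complex.conj_re, Complex.conj_im, neg_mul, sub_neg_eq_add, ← sub_eq_add_neg, Complex.zero_re,
    Complex.zero_im] at e1 e2 e3 e4 rr ii ri ir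
  have rr' : Integrable (fun ω => (X ω i).re * (X ω j).re) μ := rr
  have ii' : Integrable (fun ω => (X ω i).im * (X ω j).im) μ := ii
  have ri' : Integrable (fun ω => (X ω i).re * (X ω j).im) μ := ri
  have ir' : Integrable (fun ω => (X ω i).im * (X ω j).re) μ := ir
  rw [integral_add rr' ii'] at e1
  rw [integral_sub ri' ir'] at e2
  rw [integral_sub rr' ii'] at e3
  rw [integral_add ri' ir'] at e4
  refine ⟨?_, ?_, ?_⟩ <;> linarith

/-- A circularly-symmetric Gaussian vector with identity covariance has independent standard
complex Gaussian entries. -/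
lemma IsComplexGaussian.hasLaw_pi [DecidableEq ι] {X : Ω → ι → ℂ}
    (hX : IsComplexGaussian μ X 1) :
    HasLaw X (Measure.pi fun _ => stdComplexGaussian) μ := by
  have := hX.gaussian.isProbabilityMeasure
  have hm (i : ι) := hX.mean i
  have hint (i : ι) : Integrable (fun ω => X ω i) μ := (hX.gaussian.eval i).integrable
  have mre (i : ι) : ∫ ω, (X ω i).re ∂μ = 0 := by
    have := integral_re (hint i)
    simp only [RCLike.re_eq_complex_re] at this
    rw [this, hm i]; rfl
  have mim (i : ι) : ∫ ω, (X ω i).im ∂μ = 0 := by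
    have := integral_im (hint i)
    simp only [RCLike.im_eq_complex_im] at this
    rw [this, hm i]; rfl
  have lre (i : ι) : MemLp (fun ω => (X ω i).re) 2 μ := (hX.memLp i).re
  have lim (i : ι) : MemLp (fun ω => (X ω i).im) 2 μ := (hX.memLp i).im
  have hind : iIndepFun (fun i ω => X ω i) μ := by
    let Y : ι → Fin 2 → Ω → ℝ := fun i => ![fun ω => (X ω i).re, fun ω => (X ω i).im]
    have hYm : ∀ i k, MemLp (Y i k) 2 μ := by
      intro i k; fin_cases k
      · exact lre i
      · exact lim i
    have hY0 : ∀ i k, ∫ ω, Y i k ω ∂μ = 0 := by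
      intro i k; fin_cases k
      · exact mre i
      · exact mim i
    have hYg : HasGaussianLaw (fun ω i j ↦ Y i j ω) μ := by
      let L1 : ℂ →L[ℝ] (Fin 2 → ℝ) := ContinuousLinearMap.pi ![Complex.reCLM, Complex.imCLM]
      let L : (ι → ℂ) →L[ℝ] (ι → Fin 2 → ℝ) :=
        ContinuousLinearMap.pi fun i => L1.comp (ContinuousLinearMap.proj i)
      have hL : (fun ω i j ↦ Y i j ω) = fun ω => L (X ω) := by
        funext ω i j
        fin_cases j <;> rfl
      rw [hL]
      exact hX.gaussian.map_fun L
    -- For jointly Gaussian real pairs, independence only requires the cross-covariances to vanish.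
    -- The im-re moment is the re-im moment with `i` and `j` exchanged.
    have hYi := hYg.iIndepFun_of_covariance_eval (fun i j hij k l => by
      rw [covariance_eq_sub (hYm i k) (hYm j l), hY0, hY0, mul_zero, sub_zero]
      obtain ⟨h1, h2, h3⟩ := hX.integral_re_im i j
      obtain ⟨-, -, h4⟩ := hX.integral_re_im j i
      simp only [mul_comm (X _ j).re] at h4
      rw [Matrix.one_apply_ne hij] at h1 h2 h3
      rw [Matrix.one_apply_ne hij.symm] at h4
      simp only [Complex.zero_re, Complex.zero_im, zero_div] at h1 h2 h3 h4
      fin_cases k <;> fin_cases l <;> assumption)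
    have := hYi.comp (fun _ (v : Fin 2 → ℝ) => Complex.measurableEquivRealProd.symm (v 0, v 1))
      (fun _ => by fun_prop)
    exact this
  have hlaw (i : ι) : HasLaw (fun ω => X ω i) stdComplexGaussian μ := by
    have hg : HasGaussianLaw (fun ω => ((X ω i).re, (X ω i).im)) μ :=
      (hX.gaussian.eval i).map_fun (Complex.equivRealProdCLM : ℂ →L[ℝ] ℝ × ℝ)
    obtain ⟨h1, h2, h3⟩ := hX.integral_re_im i i
    simp only [Matrix.one_apply_eq, Complex.one_re, Complex.one_im, zero_div] at h1 h2 h3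
    have hi : IndepFun (fun ω => (X ω i).re) (fun ω => (X ω i).im) μ :=
      hg.indepFun_of_covariance_eq_zero (by
        rw [covariance_eq_sub (lre i) (lim i), mre, mim, mul_zero, sub_zero]
        exact h3)
    have hr : HasLaw (fun ω => (X ω i).re) (gaussianReal 0 (1 / 2)) μ := by
      refine ⟨(lre i).aemeasurable, ?_⟩
      rw [hg.fst.map_eq_gaussianReal, mre i, variance_eq_sub (lre i), mre i]
      have : ∫ ω, ((fun ω => (X ω i).re) ^ 2) ω ∂μ = 1 / 2 := by
        rw [← h1]; simp [sq]
      rw [this]; congr 1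
      ext; simp
    have hii : HasLaw (fun ω => (X ω i).im) (gaussianReal 0 (1 / 2)) μ := by
      refine ⟨(lim i).aemeasurable, ?_⟩
      rw [hg.snd.map_eq_gaussianReal, mim i, variance_eq_sub (lim i), mim i]
      have : ∫ ω, ((fun ω => (X ω i).im) ^ 2) ω ∂μ = 1 / 2 := by
        rw [← h2]; simp [sq]
      rw [this]; congr 1
      ext; simp
    have hpair := (indepFun_iff_hasLaw_prodMk_prod hr hii).1 hi
    refine ⟨hX.gaussian.aemeasurable.eval i, ?_⟩
    rw [stdComplexGaussian, ← hpair.map_eq, AEMeasurable.map_map_of_aemeasurable (by fun_prop)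
      hpair.aemeasurable]
    rfl
  exact hind.hasLaw_pi hlaw

end ComplexGaussian

/-! ### Moments, unitary invariance and Laplace transform of the standard Gaussian. -/

section StdComplexGaussian

instance : IsGaussian stdComplexGaussian := by
  have : stdComplexGaussian = ((gaussianReal 0 (1 / 2)).prod (gaussianReal 0 (1 / 2))).map
      Complex.equivRealProdCLM.symm := rfl
  rw [this]
  infer_instance

lemma integral_comp_isometry_stdComplexGaussian (e : ℂ ≃ₗᵢ[ℝ] ℂ) (f : ℂ → ℂ) :
    ∫ z, f (e z) ∂stdComplexGaussian = ∫ z, f z ∂stdComplexGaussian := by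
  conv_rhs => rw [← stdComplexGaussian_map_isometry e]
  exact (integral_map_equiv e.toHomeomorph.toMeasurableEquiv f).symm

lemma integral_id_stdComplexGaussian : ∫ z, z ∂stdComplexGaussian = 0 := by
  have h : ∫ z, -z ∂stdComplexGaussian = ∫ z, z ∂stdComplexGaussian :=
    integral_comp_isometry_stdComplexGaussian (LinearIsometryEquiv.neg ℝ) fun z => z
  rw [integral_neg] at h
  exact self_eq_neg.mp h.symm

/-- Rotation by `I` preserves the law and changes the sign of `z * z`. -/
lemma integral_mul_self_stdComplexGaussian : ∫ z, z * z ∂stdComplexGaussian = 0 := by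
  have h : ∫ z, Complex.I * z * (Complex.I * z) ∂stdComplexGaussian =
      ∫ z, z * z ∂stdComplexGaussian :=
    integral_comp_isometry_stdComplexGaussian
      (rotation ⟨Complex.I, by simp [Submonoid.unitSphere]⟩) fun z => z * z
  have h2 (z : ℂ) : Complex.I * z * (Complex.I * z) = -(z * z) := by
    linear_combination z * z * Complex.I_mul_I
  simp_rw [h2] at h
  rw [integral_neg] at h
  exact self_eq_neg.mp h.symm

lemma integral_conj_mul_self_stdComplexGaussian :
    ∫ z, conj z * z ∂stdComplexGaussian = 1 := by
  have h0 : ∫ x : ℝ, x ^ 2 ∂(gaussianReal 0 (1 / 2)) = 1 / 2 := by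
    have h := variance_eq_sub (memLp_id_gaussianReal (μ := 0) (v := 1 / 2) 2)
    rw [variance_id_gaussianReal] at h
    simp at h
    simpa using h.symm
  have hi : Integrable (fun x : ℝ => x ^ 2) (gaussianReal 0 (1 / 2)) :=
    (memLp_id_gaussianReal 2).integrable_sq
  have h1 (p : ℝ × ℝ) : conj (Complex.measurableEquivRealProd.symm p) *
      Complex.measurableEquivRealProd.symm p = ((p.1 ^ 2 + p.2 ^ 2 : ℝ) : ℂ) := by
    rw [← Complex.normSq_eq_conj_mul_self, Complex.normSq_apply]
    simp [Complex.measurableEquivRealProd, sq]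
  rw [stdComplexGaussian, integral_map_equiv]
  simp_rw [h1]
  rw [integral_complex_ofReal, integral_add (hi.comp_fst _) (hi.comp_snd _),
    integral_fun_fst (fun x : ℝ => x ^ 2), integral_fun_snd (fun x : ℝ => x ^ 2), h0]
  norm_num

variable {ι κ : Type*} [Fintype ι] [Fintype κ] 
-- Converse of `IsComplexGaussian.hasLaw_pi`. Together they let linear images of product measures be
-- computed from covariances alone.
lemma isComplexGaussian_pi [DecidableEq ι] :
    IsComplexGaussian (Measure.pi fun _ : ι => stdComplexGaussian) (fun w => w) 1 := by
  have hlaw (i : ι) : HasLaw (fun w : ι → ℂ => w i) stdComplexGaussian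
      (Measure.pi fun _ : ι => stdComplexGaussian) :=
    (measurePreserving_eval (fun _ : ι => stdComplexGaussian) i).hasLaw
  have hint (i : ι) : Integrable (fun w : ι → ℂ => w i)
      (Measure.pi fun _ : ι => stdComplexGaussian) :=
    (hlaw i).hasGaussianLaw.integrable
  have hind : iIndepFun (fun i (w : ι → ℂ) => w i) (Measure.pi fun _ : ι => stdComplexGaussian) :=
    iIndepFun_pi (X := fun _ z => z) fun _ => by fun_prop
  have hmean (i : ι) : ∫ w : ι → ℂ, w i ∂(Measure.pi fun _ : ι => stdComplexGaussian) = 0 := by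
    rw [(hlaw i).integral_eq, integral_id_stdComplexGaussian]
  refine ⟨hind.hasGaussianLaw fun i => (hlaw i).hasGaussianLaw, hmean, fun i j => ?_, fun i j => ?_⟩
  · rcases eq_or_ne i j with rfl | hij
    · have := (hlaw i).integral_comp (f := fun z => conj z * z) (by fun_prop)
      rw [Matrix.one_apply_eq, ← integral_conj_mul_self_stdComplexGaussian, ← this]
      rfl
    · rw [Matrix.one_apply_ne hij]
      have h2 : IndepFun (fun w : ι → ℂ => conj (w i)) (fun w => w j)
          (Measure.pi fun _ : ι => stdComplexGaussian) :=
        (hind.indepFun hij).comp (φ := fun z => conj z) (ψ := fun z => z) (by fun_prop) (by fun_prop)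
      rw [h2.integral_fun_mul_eq_mul_integral
        (Complex.continuous_conj.comp_aestronglyMeasurable (hint i).aestronglyMeasurable)
        (hint j).aestronglyMeasurable, hmean, mul_zero]
  · rcases eq_or_ne i j with rfl | hij
    · have := (hlaw i).integral_comp (f := fun z => z * z) (by fun_prop)
      rw [← integral_mul_self_stdComplexGaussian, ← this]
      rfl
    · rw [(hind.indepFun hij).integral_fun_mul_eq_mul_integral (hint i).aestronglyMeasurable
        (hint j).aestronglyMeasurable, hmean, zero_mul]

/-- The image is Gaussian with covariance `conj A * Aᵀ`, the entrywise conjugate of `A * Aᴴ = 1`,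
and such a vector has the product law. -/
lemma pi_stdComplexGaussian_map_mulVec [DecidableEq κ] (A : Matrix κ ι ℂ) (hA : A * Aᴴ = 1) :
    (Measure.pi fun _ : ι => stdComplexGaussian).map (A *ᵥ ·) =
      Measure.pi fun _ : κ => stdComplexGaussian := by
  classical
  have h := isComplexGaussian_pi.mulVec (ι := ι) A
  have hA' : A.map (starRingEnd ℂ) * (1 : Matrix ι ι ℂ) * Aᵀ = 1 := by
    have := congrArg (fun B => B.map (starRingEnd ℂ)) hA
    simp only [Matrix.map_mul] at this
    rw [Matrix.mul_one]
    convert this using 1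
    · congr 1; ext i j; simp
    · ext i j; simp [Matrix.one_apply]
  rw [hA'] at h
  exact h.hasLaw_pi.map_eq

lemma lintegral_exp_neg_mul_sq_stdComplexGaussian {t : ℝ} (ht : 0 ≤ t) :
    ∫⁻ z, ENNReal.ofReal (Real.exp (-(t * ‖z‖ ^ 2))) ∂stdComplexGaussian =
      ENNReal.ofReal (1 + t)⁻¹ := by
  have h1 : 0 < 1 + t := by positivity
  have h := GaussianFourier.integral_rexp_neg_mul_sq_norm (V := ℂ) h1
  rw [Complex.finrank_real_complex] at h
  simp only [neg_mul, Nat.cast_ofNat, ne_eq, OfNat.ofNat_ne_zero, not_false_eq_true, div_self,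
    Real.rpow_one] at h
  have hi : Integrable fun z : ℂ => Real.exp (-((1 + t) * ‖z‖ ^ 2)) := by
    refine Integrable.of_integral_ne_zero ?_
    rw [h]; positivity
  rw [stdComplexGaussian_eq_withDensity, lintegral_withDensity_eq_lintegral_mul _ (by fun_prop)
    (by fun_prop)]
  simp only [Pi.mul_apply]
  have (z : ℂ) : ENNReal.ofReal (Real.pi⁻¹ * Real.exp (-‖z‖ ^ 2)) *
      ENNReal.ofReal (Real.exp (-(t * ‖z‖ ^ 2))) =
      ENNReal.ofReal (Real.pi⁻¹ * Real.exp (-((1 + t) * ‖z‖ ^ 2))) := by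
    rw [← ENNReal.ofReal_mul (by positivity), mul_assoc, ← Real.exp_add]
    ring_nf
  simp_rw [this]
  rw [← ofReal_integral_eq_lintegral_ofReal (hi.const_mul _) (.of_forall fun z => by positivity),
    integral_const_mul, h]
  congr 1
  field_simp

lemma lintegral_exp_neg_mul_sum_sq_pi_stdComplexGaussian {t : ℝ} (ht : 0 ≤ t) :
    ∫⁻ w, ENNReal.ofReal (Real.exp (-(t * ∑ i, ‖w i‖ ^ 2)))
      ∂(Measure.pi fun _ : ι => stdComplexGaussian) =
      ENNReal.ofReal ((1 + t)⁻¹ ^ Fintype.card ι) := by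
  have hind : iIndepFun (fun i (w : ι → ℂ) => ENNReal.ofReal (Real.exp (-(t * ‖w i‖ ^ 2))))
      (Measure.pi fun _ : ι => stdComplexGaussian) :=
    iIndepFun_pi (X := fun _ z => ENNReal.ofReal (Real.exp (-(t * ‖z‖ ^ 2))))
      fun _ => by fun_prop
  have (w : ι → ℂ) : ENNReal.ofReal (Real.exp (-(t * ∑ i, ‖w i‖ ^ 2))) =
      ∏ i, ENNReal.ofReal (Real.exp (-(t * ‖w i‖ ^ 2))) := by
    rw [← ENNReal.ofReal_prod_of_nonneg fun _ _ => by positivity, ← Real.exp_sum,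
      Finset.mul_sum, Finset.sum_neg_distrib]
  simp_rw [this]
  rw [lintegral_prod_eq_prod_lintegral_of_indepFun _ _ hind fun _ => by fun_prop]
  have h2 (i : ι) : ∫⁻ w : ι → ℂ, ENNReal.ofReal (Real.exp (-(t * ‖w i‖ ^ 2)))
      ∂(Measure.pi fun _ : ι => stdComplexGaussian) = ENNReal.ofReal (1 + t)⁻¹ := by
    rw [(measurePreserving_eval (fun _ : ι => stdComplexGaussian) i).lintegral_comp
      (f := fun z : ℂ => ENNReal.ofReal (Real.exp (-(t * ‖z‖ ^ 2)))) (by fun_prop),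
      lintegral_exp_neg_mul_sq_stdComplexGaussian ht]
  simp_rw [h2]
  rw [Finset.prod_const, ENNReal.ofReal_pow (by positivity), Finset.card_univ]

end StdComplexGaussian

/-! ### Projections of Gaussian vectors and generic linear independence. -/

section Projection

/-- In an orthonormal basis of `V` the coordinates of the projection are `A *ᵥ w` with `A * Aᴴ = 1`,
hence `finrank V` independent standard Gaussians. -/
lemma lintegral_exp_neg_mul_sq_norm_starProjection {n : ℕ}
    (V : Submodule ℂ (EuclideanSpace ℂ (Fin n))) {t : ℝ} (ht : 0 ≤ t) :
    ∫⁻ w, ENNReal.ofReal (Real.exp (-(t * ‖V.starProjection (WithLp.toLp 2 w)‖ ^ 2)))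
      ∂(Measure.pi fun _ : Fin n => stdComplexGaussian) =
      ENNReal.ofReal ((1 + t)⁻¹ ^ Module.finrank ℂ V) := by
  let b := stdOrthonormalBasis ℂ V
  let A : Matrix (Fin (Module.finrank ℂ V)) (Fin n) ℂ :=
    Matrix.of fun i m => conj ((b i : EuclideanSpace ℂ (Fin n)) m)
  have hAw (w : Fin n → ℂ) (i) :
      (A *ᵥ w) i = inner ℂ (b i : EuclideanSpace ℂ (Fin n)) (WithLp.toLp 2 w) := by
    simp [A, Matrix.mulVec, dotProduct, PiLp.inner_apply, mul_comm]
  have hA : A * Aᴴ = 1 := by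
    ext i j
    have h := orthonormal_iff_ite.1 b.orthonormal i j
    rw [Matrix.one_apply, ← h, Submodule.coe_inner, PiLp.inner_apply, Matrix.mul_apply]
    refine Finset.sum_congr rfl fun m _ => ?_
    simp [A, mul_comm]
  have hnorm (w : Fin n → ℂ) :
      ‖V.starProjection (WithLp.toLp 2 w)‖ ^ 2 = ∑ i, ‖(A *ᵥ w) i‖ ^ 2 := by
    have h1 := b.sum_sq_norm_inner_right (V.orthogonalProjectionOnto (WithLp.toLp 2 w))
    have h2 : ‖V.orthogonalProjectionOnto (WithLp.toLp 2 w)‖ =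
      ‖V.starProjection (WithLp.toLp 2 w)‖ := rfl
    rw [← h2, ← h1]
    refine Finset.sum_congr rfl fun i _ => ?_
    rw [hAw, Submodule.inner_orthogonalProjectionOnto_eq_of_mem_left]
  simp_rw [hnorm]
  have h := lintegral_exp_neg_mul_sum_sq_pi_stdComplexGaussian
    (ι := Fin (Module.finrank ℂ V)) ht
  rw [← pi_stdComplexGaussian_map_mulVec A hA, lintegral_map (by fun_prop)
    (continuous_const.matrix_mulVec continuous_id' : Continuous (A *ᵥ ·)).measurable, Fintype.card_fin] at h
  exact h

/-- On `V` the projection to `Vᗮ ≠ 0` vanishes, so there `exp(-t ‖·‖²)` equals `1`. Markov's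
inequality bounds the measure by a Laplace transform that tends to `0` as `t → ∞`. -/
lemma pi_stdComplexGaussian_submodule_eq_zero {n : ℕ}
    (V : Submodule ℂ (EuclideanSpace ℂ (Fin n))) (hV : V ≠ ⊤) :
    (Measure.pi fun _ : Fin n => stdComplexGaussian) {w | WithLp.toLp 2 w ∈ V} = 0 := by
  set P := Measure.pi fun _ : Fin n => stdComplexGaussian
  have hpos : 1 ≤ Module.finrank ℂ Vᗮ := by
    rw [Nat.one_le_iff_ne_zero, ne_eq, Submodule.finrank_eq_zero, Submodule.orthogonal_eq_bot_iff]
    exact hV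
  have hbound (t : ℝ) (ht : 0 ≤ t) : P {w | WithLp.toLp 2 w ∈ V} ≤ ENNReal.ofReal (1 + t)⁻¹ := by
    calc P {w | WithLp.toLp 2 w ∈ V}
        ≤ P {w | 1 ≤ ENNReal.ofReal
            (Real.exp (-(t * ‖Vᗮ.starProjection (WithLp.toLp 2 w)‖ ^ 2)))} := by
          refine measure_mono fun w hw => ?_
          have : Vᗮ.starProjection (WithLp.toLp 2 w) = 0 :=
            (Submodule.starProjection_apply_eq_zero_iff _).2
              (by rw [Submodule.orthogonal_orthogonal]; exact hw)
          rw [Set.mem_ofPred_eq, this]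
          simp
      _ ≤ _ := by
          have := mul_meas_ge_le_lintegral₀ (μ := P) (f := fun w => ENNReal.ofReal
            (Real.exp (-(t * ‖Vᗮ.starProjection (WithLp.toLp 2 w)‖ ^ 2)))) (by fun_prop) 1
          rwa [one_mul] at this
      _ = _ := lintegral_exp_neg_mul_sq_norm_starProjection _ ht
      _ ≤ _ := by
          refine ENNReal.ofReal_le_ofReal ?_
          have h1 : (1 + t)⁻¹ ≤ 1 := inv_le_one_of_one_le₀ (by linarith)
          exact (pow_le_pow_of_le_one (by positivity) h1 hpos).trans_eq (pow_one _)
  have hlim : Filter.Tendsto (fun t : ℝ => ENNReal.ofReal (1 + t)⁻¹) Filter.atTop (nhds 0) := by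
    rw [← ENNReal.ofReal_zero]
    exact ENNReal.tendsto_ofReal
      (tendsto_inv_atTop_zero.comp (Filter.tendsto_atTop_add_const_left _ 1 Filter.tendsto_id))
  refine le_antisymm (ge_of_tendsto hlim ?_) (zero_le)
  filter_upwards [Filter.eventually_ge_atTop 0] with t ht using hbound t ht

/-- By induction: given `k < n` independent vectors, their span is a proper subspace, which an
independent Gaussian vector almost surely avoids. -/
lemma ae_linearIndependent_pi_stdComplexGaussian {n : ℕ} (k : ℕ) (hk : k ≤ n) :
    ∀ᵐ g ∂(Measure.pi fun _ : Fin k => Measure.pi fun _ : Fin n => stdComplexGaussian),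
      LinearIndependent ℂ g := by
  induction k with
  | zero => exact .of_forall fun g => linearIndependent_empty_type
  | succ k ih =>
    set P := Measure.pi fun _ : Fin n => stdComplexGaussian
    have hmp := measurePreserving_piFinSuccAbove (fun _ : Fin (k + 1) => P) 0
    have hmeas : MeasurableSet
        {p : (Fin n → ℂ) × (Fin k → Fin n → ℂ) |
          LinearIndependent ℂ (Fin.cons p.1 p.2 : Fin (k + 1) → Fin n → ℂ)} := by
      refine IsOpen.measurableSet (isOpen_setOfPred_linearIndependent.preimage ?_)
      refine continuous_pi fun i => ?_
      refine Fin.cases ?_ (fun j => ?_) i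
      · simpa using continuous_fst
      · simp only [Fin.cons_succ]
        fun_prop
    have key : ∀ᵐ p ∂(P.prod (Measure.pi fun _ : Fin k => P)),
        LinearIndependent ℂ (Fin.cons p.1 p.2 : Fin (k + 1) → Fin n → ℂ) := by
      -- The swap puts the old vectors outside, so that the new vector is drawn with their span
      -- fixed.
      rw [← Measure.prod_swap, ae_map_iff (by fun_prop) hmeas]
      refine (Measure.ae_prod_iff_ae_ae (measurable_swap hmeas)).2 ?_
      filter_upwards [ih (by omega)] with g hg
      let V : Submodule ℂ (EuclideanSpace ℂ (Fin n)) :=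
        (Submodule.span ℂ (Set.range g)).map (WithLp.linearEquiv 2 ℂ (Fin n → ℂ)).symm.toLinearMap
      have hV : V ≠ ⊤ := by
        intro h
        have h1 : Module.finrank ℂ V = n := by rw [h]; simp
        rw [LinearEquiv.finrank_map_eq, finrank_span_eq_card hg, Fintype.card_fin] at h1
        omega
      have := pi_stdComplexGaussian_submodule_eq_zero V hV
      filter_upwards [measure_eq_zero_iff_ae_notMem.1 this] with w hw
      refine linearIndependent_finCons.2 ⟨hg, fun h => hw ?_⟩
      exact Submodule.mem_map_of_mem h
    filter_upwards [hmp.quasiMeasurePreserving.ae key] with g hg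
    convert hg using 1
    ext i
    refine Fin.cases ?_ (fun j => ?_) i <;> simp [MeasurableEquiv.piFinSuccAbove, Fin.tail]

end Projection

/-! ### Diagonal entries of the inverse Gram matrix. -/

section GramInverse

variable {α ι κ l : Type*} [MeasurableSpace α]

lemma measurable_matrix_mul [Fintype κ] {f : α → Matrix ι κ ℂ} {g : α → Matrix κ l ℂ}
    (hf : ∀ i j, Measurable fun a => f a i j) (hg : ∀ i j, Measurable fun a => g a i j) (i : ι)
    (j : l) : Measurable fun a => (f a * g a) i j := by
  simp only [Matrix.mul_apply]
  exact Finset.measurable_fun_sum _ fun m _ => (hf i m).mul (hg m j)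

lemma measurable_matrix_conjTranspose {f : α → Matrix ι κ ℂ}
    (hf : ∀ i j, Measurable fun a => f a i j) (i : κ) (j : ι) :
    Measurable fun a => (f a)ᴴ i j := by
  simp only [Matrix.conjTranspose_apply]
  exact Complex.continuous_conj.measurable.comp (hf j i)

variable [Fintype ι] [DecidableEq ι]

lemma measurable_matrix_det {f : α → Matrix ι ι ℂ}
    (hf : ∀ i j, Measurable fun a => f a i j) : Measurable fun a => (f a).det := by
  simp only [Matrix.det_apply]
  exact Finset.measurable_fun_sum _ fun σ _ =>
    (Finset.measurable_fun_prod _ fun i _ => hf _ _).const_smul _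

lemma measurable_matrix_inv {f : α → Matrix ι ι ℂ}
    (hf : ∀ i j, Measurable fun a => f a i j) (i j : ι) : Measurable fun a => (f a)⁻¹ i j := by
  simp only [Matrix.inv_def, Matrix.smul_apply, Ring.inverse_eq_inv', Matrix.adjugate_apply]
  refine (measurable_matrix_det hf).inv.smul (measurable_matrix_det fun a b => ?_)
  by_cases h : a = j
  · simp [h]
  · simpa [Matrix.updateRow_ne h] using hf a b

lemma isUnit_conjTranspose_mul_self_of_linearIndependent {n : ℕ} {g : ι → Fin n → ℂ}
    (hg : LinearIndependent ℂ g) : IsUnit ((Matrix.of g)ᵀᴴ * (Matrix.of g)ᵀ) :=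
  (Matrix.PosDef.conjTranspose_mul_self _ (Matrix.mulVec_injective_iff.2 hg)).isUnit

/-- The diagonal entries of the inverse Gram matrix are the inverse squared distances of the
vectors to the span of the other ones. -/
lemma conjTranspose_mul_self_inv_apply_self {n d : ℕ} {g : Fin (d + 1) → Fin n → ℂ}
    (hg : LinearIndependent ℂ g) (k : Fin (d + 1)) :
    ((Matrix.of g)ᵀᴴ * (Matrix.of g)ᵀ)⁻¹ k k =
      ((‖(Submodule.span ℂ (Set.range fun j => WithLp.toLp 2 (g (k.succAbove j))))ᗮ.starProjection
        (WithLp.toLp 2 (g k))‖ ^ 2 : ℝ) : ℂ)⁻¹ := by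
  set V := Submodule.span ℂ (Set.range fun j => WithLp.toLp 2 (g (k.succAbove j)))
  set p := Vᗮ.starProjection (WithLp.toLp 2 (g k)) with hp
  set G := (Matrix.of g)ᵀ with hG
  have hpV : p ∈ Vᗮ := Submodule.starProjection_apply_mem _ _
  obtain ⟨c, hc⟩ := (Submodule.mem_span_range_iff_exists_fun ℂ).1
    (Submodule.starProjection_apply_mem V (WithLp.toLp 2 (g k)))
  have hsum : V.starProjection (WithLp.toLp 2 (g k)) + p = WithLp.toLp 2 (g k) :=
    Submodule.starProjection_add_starProjection_orthogonal _
  have hort : ∀ j, inner ℂ (WithLp.toLp 2 (g (k.succAbove j))) p = 0 := fun j =>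
    Submodule.inner_right_of_mem_orthogonal (Submodule.subset_span (Set.mem_range_self j)) hpV
  have hself : inner ℂ (WithLp.toLp 2 (g k)) p = ((‖p‖ ^ 2 : ℝ) : ℂ) := by
    rw [← hsum, inner_add_left, Submodule.inner_right_of_mem_orthogonal
      (Submodule.starProjection_apply_mem V _) hpV, zero_add, inner_self_eq_norm_sq_to_K]
    simp
  -- `y` expresses the residual `p` in the vectors `g`: coefficient `1` at `k`, minus the projection
  -- coefficients elsewhere. As `p` is orthogonal to every vector but `g k`, the Gram matrix sends
  -- `y` to `‖p‖² e_k`; reading coordinate `k` after inversion gives the formula.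
  let y : Fin (d + 1) → ℂ := Fin.insertNth (α := fun _ => ℂ) k 1 (-c)
  have hy : G *ᵥ y = p.ofLp := by
    have h1 : p = WithLp.toLp 2 (g k) - ∑ j, c j • WithLp.toLp 2 (g (k.succAbove j)) := by
      rw [hc]; exact eq_sub_of_add_eq' hsum
    ext m
    rw [h1]
    simp [Matrix.mulVec, dotProduct, Fin.sum_univ_succAbove _ k, y, hG, Finset.sum_neg_distrib,
      sub_eq_add_neg, mul_comm]
  have hin (j : Fin (d + 1)) : (Gᴴ *ᵥ p.ofLp) j = inner ℂ (WithLp.toLp 2 (g j)) p := by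
    simp [Matrix.mulVec, dotProduct, hG, PiLp.inner_apply, mul_comm]
  have hgram : (Gᴴ * G) *ᵥ y = ((‖p‖ ^ 2 : ℝ) : ℂ) • Pi.single k 1 := by
    rw [← Matrix.mulVec_mulVec, hy]
    ext j
    rw [hin]
    rcases Fin.eq_self_or_eq_succAbove k j with rfl | ⟨i, rfl⟩
    · simpa using hself
    · rw [hort]; simp
  have hunit := isUnit_conjTranspose_mul_self_of_linearIndependent hg
  have h2 : y = ((‖p‖ ^ 2 : ℝ) : ℂ) • ((Gᴴ * G)⁻¹ *ᵥ Pi.single k 1) := by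
    rw [← Matrix.mulVec_smul, ← hgram, Matrix.mulVec_mulVec,
      Matrix.nonsing_inv_mul _ ((Matrix.isUnit_iff_isUnit_det _).1 hunit), Matrix.one_mulVec]
  have h3 := congrFun h2 k
  simp only [y, Fin.insertNth_apply_same, Pi.smul_apply, Matrix.mulVec_single_one, smul_eq_mul,
    Matrix.col_apply] at h3
  exact eq_inv_of_mul_eq_one_right h3.symm

/-- With the other `d` columns fixed, the inverse entry is the squared norm of the projection of
column `k`, which is independent of them, onto a space of dimension `n - d`. The inner integral
therefore does not depend on those columns. -/
lemma lintegral_exp_neg_mul_inv_gram_inv {n d : ℕ} (hd : d + 1 ≤ n) (k : Fin (d + 1)) {t : ℝ}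
    (ht : 0 ≤ t) :
    ∫⁻ g : Fin (d + 1) → Fin n → ℂ, ENNReal.ofReal (Real.exp
        (-(t * (((Matrix.of g)ᵀᴴ * (Matrix.of g)ᵀ)⁻¹ k k).re⁻¹)))
      ∂(Measure.pi fun _ => Measure.pi fun _ => stdComplexGaussian) =
      ENNReal.ofReal ((1 + t)⁻¹ ^ (n - d)) := by
  set P := Measure.pi fun _ : Fin n => stdComplexGaussian
  set f : (Fin (d + 1) → Fin n → ℂ) → ENNReal := fun g => ENNReal.ofReal (Real.exp
        (-(t * (((Matrix.of g)ᵀᴴ * (Matrix.of g)ᵀ)⁻¹ k k).re⁻¹))) with hf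
  have hfm : Measurable f := by
    have h1 (i j) : Measurable fun g : Fin (d + 1) → Fin n → ℂ => (Matrix.of g)ᵀ i j := by
      simp only [Matrix.transpose_apply, Matrix.of_apply]; fun_prop
    have := measurable_matrix_inv
      (measurable_matrix_mul (measurable_matrix_conjTranspose h1) h1) k k
    exact (Real.measurable_exp.comp
      ((Complex.measurable_re.comp this).inv.const_mul t).neg).ennreal_ofReal
  have hfg (g : Fin (d + 1) → Fin n → ℂ) (hg : LinearIndependent ℂ g) :
      f g = ENNReal.ofReal (Real.exp (-(t * ‖(Submodule.span ℂ (Set.range fun j =>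
        WithLp.toLp 2 (g (k.succAbove j))))ᗮ.starProjection (WithLp.toLp 2 (g k))‖ ^ 2))) := by
    rw [hf]
    dsimp only
    rw [conjTranspose_mul_self_inv_apply_self hg k, ← Complex.ofReal_inv, Complex.ofReal_re,
      inv_inv]
  have hmp := measurePreserving_piFinSuccAbove (fun _ : Fin (d + 1) => P) k
  have hLI := ae_linearIndependent_pi_stdComplexGaussian (n := n) (d + 1) hd
  have hLI' := (hmp.symm _).quasiMeasurePreserving.ae hLI
  have hcomp := (hmp.symm _).lintegral_comp hfm
  refine hcomp.symm.trans ((lintegral_prod_symm _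
    (hfm.comp (MeasurableEquiv.measurable _)).aemeasurable).trans ?_)
  rw [← Measure.prod_swap] at hLI'
  have hae := Measure.ae_ae_of_ae_prod (ae_of_ae_map measurable_swap.aemeasurable hLI')
  have hLId := ae_linearIndependent_pi_stdComplexGaussian (n := n) d (by omega)
  have hinner : ∀ᵐ h ∂(Measure.pi fun _ : Fin d => P),
      ∫⁻ w, f ((MeasurableEquiv.piFinSuccAbove (fun _ => Fin n → ℂ) k).symm (w, h)) ∂P =
        ENNReal.ofReal ((1 + t)⁻¹ ^ (n - d)) := by
    filter_upwards [hae, hLId] with h hh hLIh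
    let V := Submodule.span ℂ (Set.range fun j => WithLp.toLp 2 (h j))
    have hV : Module.finrank ℂ Vᗮ = n - d := by
      have h1 : Module.finrank ℂ V = d := by
        have := hLIh.map' (WithLp.linearEquiv 2 ℂ (Fin n → ℂ)).symm.toLinearMap
          (LinearEquiv.ker _)
        exact (finrank_span_eq_card this).trans (Fintype.card_fin d)
      have h2 := V.finrank_add_finrank_orthogonal
      rw [finrank_euclideanSpace, Fintype.card_fin] at h2
      omega
    rw [← hV, ← lintegral_exp_neg_mul_sq_norm_starProjection Vᗮ ht]
    refine lintegral_congr_ae ?_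
    filter_upwards [hh] with w hw
    have hw' := hfg _ hw
    have h1 : (MeasurableEquiv.piFinSuccAbove (fun _ => Fin n → ℂ) k).symm (w, h) k = w :=
      Fin.insertNth_apply_same (α := fun _ => Fin n → ℂ) k w h
    have h2 (j) : (MeasurableEquiv.piFinSuccAbove (fun _ => Fin n → ℂ) k).symm (w, h)
        (k.succAbove j) = h j :=
      Fin.insertNth_apply_succAbove (α := fun _ => Fin n → ℂ) k w h j
    simp only [Prod.swap, h1, h2] at hw'
    exact hw'
  refine (lintegral_congr_ae hinner).trans ?_
  rw [lintegral_const, measure_univ, mul_one]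

end GramInverse

/-! ### Reduction of the correlated channel to independent standard columns. -/

section Whitening

lemma exists_unitary_mulVec_eq_single {n : ℕ} (k : Fin n) (u : EuclideanSpace ℂ (Fin n))
    (hu : ‖u‖ = 1) : ∃ U : Matrix (Fin n) (Fin n) ℂ, Uᴴ * U = 1 ∧ ∀ i, U i k = u i := by
  have hv : Orthonormal ℂ (({k} : Set (Fin n)).domRestrict fun _ => u) := by
    refine ⟨fun _ => hu, fun i j hij => ?_⟩
    exact absurd (Subsingleton.elim i j) hij
  obtain ⟨b, hb⟩ := hv.exists_orthonormalBasis_extension_of_card_eq (by simp)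
  refine ⟨Matrix.of fun i j => b j i, ?_, fun i => ?_⟩
  · ext i j
    have h := orthonormal_iff_ite.1 b.orthonormal i j
    rw [Matrix.one_apply, ← h, PiLp.inner_apply, Matrix.mul_apply]
    exact Finset.sum_congr rfl fun m _ => by simp [mul_comm]
  · rw [Matrix.of_apply, hb k rfl]

open scoped MatrixOrder in
/-- A matrix that whitens the covariance `K` and whose `k`-th row is a multiple of the `k`-th
coordinate vector. -/
lemma Matrix.PosDef.exists_whitening {n : ℕ} {K : Matrix (Fin n) (Fin n) ℂ} (hK : K.PosDef)
    (k : Fin n) : 0 < (K⁻¹ k k).re ∧ ∃ T : Matrix (Fin n) (Fin n) ℂ, IsUnit T ∧ Tᴴ * K * T = 1 ∧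
      ∀ j, T k j = if j = k then ((√(K⁻¹ k k).re : ℝ) : ℂ) else 0 := by
  have hx : 0 < K⁻¹ k k := hK.inv.diag_pos
  obtain ⟨hx0, hxi⟩ := Complex.pos_iff.1 hx
  refine ⟨hx0, ?_⟩
  set x := (K⁻¹ k k).re with hxdef
  have hKx : K⁻¹ k k = (x : ℂ) := Complex.ext rfl (by simpa using hxi.symm)
  obtain ⟨S, hS⟩ : ∃ S : Matrix (Fin n) (Fin n) ℂ, K = Sᴴ * S :=
    CStarAlgebra.nonneg_iff_eq_star_mul_self.1 hK.posSemidef.nonneg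
  have hSu : IsUnit S := by
    have := hK.isUnit
    rw [hS] at this
    exact isUnit_of_mul_isUnit_right this
  have hSdet := (Matrix.isUnit_iff_isUnit_det _).1 hSu
  have hinv : K⁻¹ = S⁻¹ * (S⁻¹)ᴴ := by
    rw [hS, Matrix.mul_inv_rev, Matrix.conjTranspose_nonsing_inv]
  have hsx : (√x : ℂ) * √x = x := by exact_mod_cast Real.mul_self_sqrt hx0.le
  have hsx0 : (√x : ℂ) ≠ 0 := by exact_mod_cast (Real.sqrt_pos.2 hx0).ne'
  -- Since `K⁻¹ = S⁻¹ (S⁻¹)ᴴ`, row `k` of `S⁻¹` has norm `√x`. With its normalized conjugate as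
  -- column `k` of a unitary `U`, row `k` of `S⁻¹ * U` becomes `√x e_k`, and `S⁻¹ * U` still whitens
  -- `K`.
  let u : EuclideanSpace ℂ (Fin n) := WithLp.toLp 2 fun i => conj (S⁻¹ k i) / √x
  have hsum : ∑ i, S⁻¹ k i * conj (S⁻¹ k i) = x := by
    rw [← hKx, hinv, Matrix.mul_apply]
    rfl
  have hu : ‖u‖ = 1 := by
    have h1 : ((‖u‖ ^ 2 : ℝ) : ℂ) = 1 := by
      have := inner_self_eq_norm_sq_to_K (𝕜 := ℂ) u
      rw [Complex.ofReal_pow]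
      refine this.symm.trans ?_
      rw [PiLp.inner_apply]
      have h2 (i) : inner ℂ (u i) (u i) = S⁻¹ k i * conj (S⁻¹ k i) / x := by
        rw [RCLike.inner_apply, ← hsx]
        simp only [u, map_div₀, Complex.conj_conj, Complex.conj_ofReal]
        field_simp
      simp_rw [h2, ← Finset.sum_div, hsum]
      exact div_self (by exact_mod_cast hx0.ne')
    have h3 : ‖u‖ ^ 2 = 1 := by exact_mod_cast h1
    exact (pow_eq_one_iff_of_nonneg (norm_nonneg u) two_ne_zero).1 h3
  obtain ⟨U, hU, hUk⟩ := exists_unitary_mulVec_eq_single k u hu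
  have hU' : IsUnit U := IsUnit.of_mul_eq_one_right _ hU
  refine ⟨S⁻¹ * U, ?_, ?_, ?_⟩
  · exact ((Matrix.isUnit_nonsing_inv_iff).2 hSu).mul hU'
  · rw [Matrix.conjTranspose_mul, hS]
    calc Uᴴ * S⁻¹ᴴ * (Sᴴ * S) * (S⁻¹ * U) = Uᴴ * (S * S⁻¹)ᴴ * (S * S⁻¹) * U := by
          rw [Matrix.conjTranspose_mul]; simp only [Matrix.mul_assoc]
      _ = 1 := by rw [Matrix.mul_nonsing_inv _ hSdet]; simpa using hU
  · intro j
    have hrow (i) : S⁻¹ k i = √x * conj (U i k) := by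
      rw [hUk]
      simp only [u, map_div₀, Complex.conj_conj, Complex.conj_ofReal]
      field_simp
    have h4 : ∑ i, conj (U i k) * U i j = if j = k then 1 else 0 := by
      have := congrFun (congrFun hU k) j
      rw [Matrix.mul_apply, Matrix.one_apply] at this
      simp only [eq_comm (a := k)] at this
      exact this
    rw [Matrix.mul_apply]
    simp_rw [hrow, mul_assoc]
    rw [← Finset.mul_sum, h4]
    split_ifs <;> simp

variable {Ω ι κ : Type*} [MeasurableSpace Ω] [Fintype ι] [Fintype κ] {μ : Measure Ω}

lemma IsComplexGaussian.reindex {X : Ω → ι → ℂ} {C : Matrix ι ι ℂ} (hX : IsComplexGaussian μ X C)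
    (e : κ → ι) : IsComplexGaussian μ (fun ω i => X ω (e i)) (C.submatrix e e) where
  gaussian := hX.gaussian.map_fun
    (ContinuousLinearMap.pi fun i => ContinuousLinearMap.proj (e i) : (ι → ℂ) →L[ℝ] (κ → ℂ))
  mean i := hX.mean (e i)
  covariance i j := hX.covariance (e i) (e j)
  pseudocovariance i j := hX.pseudocovariance (e i) (e j)

/-- The columns of a whitened Gaussian channel are independent standard Gaussian vectors. -/
lemma hasLaw_whitened_channel {Nr Nt : ℕ} {Sig Q : Matrix (Fin Nt) (Fin Nt) ℂ}
    {H : Ω → Matrix (Fin Nr) (Fin Nt) ℂ}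
    (hH : IsComplexGaussian μ (fun ω (p : Fin Nr × Fin Nt) => H ω p.1 p.2)
      ((1 : Matrix (Fin Nr) (Fin Nr) ℂ) ⊗ₖ Sig)) (hQ : Qᴴ * Sig * Q = 1) :
    HasLaw (fun ω j m => (H ω * Q) m j)
      (Measure.pi fun _ : Fin Nt => Measure.pi fun _ : Fin Nr => stdComplexGaussian) μ := by
  -- Right multiplication of `H` by `Q` acts on the vectorized channel as `1 ⊗ₖ Qᵀ`.
  have h1 := hH.mulVec ((1 : Matrix (Fin Nr) (Fin Nr) ℂ) ⊗ₖ Qᵀ)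
  have h2 : ((1 : Matrix (Fin Nr) (Fin Nr) ℂ) ⊗ₖ Qᵀ).map (starRingEnd ℂ) =
      (1 : Matrix (Fin Nr) (Fin Nr) ℂ) ⊗ₖ Qᴴ := by
    ext p q
    simp [Matrix.one_apply, apply_ite (starRingEnd ℂ)]
  have h3 : ((1 : Matrix (Fin Nr) (Fin Nr) ℂ) ⊗ₖ Qᵀ)ᵀ = (1 : Matrix (Fin Nr) (Fin Nr) ℂ) ⊗ₖ Q := by
    rw [← Matrix.kroneckerMap_transpose]; simp
  rw [h2, h3, ← Matrix.mul_kronecker_mul, ← Matrix.mul_kronecker_mul, hQ, Matrix.one_mul,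
    Matrix.one_mul, Matrix.one_kronecker_one] at h1
  -- The indices are swapped so that currying groups the entries by columns.
  have h4 := h1.reindex (Prod.swap : Fin Nt × Fin Nr → Fin Nr × Fin Nt)
  rw [Matrix.submatrix_one _ Prod.swap_injective] at h4
  have h5 := h4.hasLaw_pi
  rw [← Measure.infinitePi_eq_pi] at h5
  have h6 := Measure.infinitePi_map_curry
    (fun (_ : Fin Nt) (_ : Fin Nr) => stdComplexGaussian)
  have h7 := HasLaw.comp ⟨(MeasurableEquiv.curry (Fin Nt) (Fin Nr) ℂ).measurable.aemeasurable, h6⟩ h5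
  simp_rw [Measure.infinitePi_eq_pi] at h7
  convert h7 using 1
  ext ω j m
  simp [MeasurableEquiv.curry, Matrix.mulVec, dotProduct, Fintype.sum_prod_type, Matrix.mul_apply,
    Matrix.one_apply, mul_comm]

/-- The distribution of the post-detection noise amplification of a zero-forcing receiver: the
inverse of `[((HF)ᴴ(HF))⁻¹]ₖₖ` has the Laplace transform of a Gamma law. -/
lemma channel_gram_inv {Nr Nt : ℕ} (hNt : 1 ≤ Nt) (hN : Nt ≤ Nr)
    {F Sig : Matrix (Fin Nt) (Fin Nt) ℂ} (hF : IsUnit F) (hSig : Sig.PosDef)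
    {H : Ω → Matrix (Fin Nr) (Fin Nt) ℂ}
    (hH : IsComplexGaussian μ (fun ω (p : Fin Nr × Fin Nt) => H ω p.1 p.2)
      ((1 : Matrix (Fin Nr) (Fin Nr) ℂ) ⊗ₖ Sig)) (k : Fin Nt) :
    0 < ((Fᴴ * Sig * F)⁻¹ k k).re ∧ (∀ᵐ ω ∂μ, IsUnit ((H ω * F)ᴴ * (H ω * F))) ∧
    ∀ t : ℝ, 0 ≤ t →
      ∫⁻ ω, ENNReal.ofReal (Real.exp (-(t * (((H ω * F)ᴴ * (H ω * F))⁻¹ k k).re⁻¹))) ∂μ =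
        ENNReal.ofReal ((1 + t / ((Fᴴ * Sig * F)⁻¹ k k).re)⁻¹ ^ (Nr - Nt + 1)) := by
  have hK : (Fᴴ * Sig * F).PosDef :=
    hSig.conjTranspose_mul_mul_same (Matrix.mulVec_injective_of_isUnit hF)
  obtain ⟨hx, T, hT, hTK, hTk⟩ := hK.exists_whitening k
  set x := ((Fᴴ * Sig * F)⁻¹ k k).re
  refine ⟨hx, ?_⟩
  have hlaw := hasLaw_whitened_channel (Q := F * T) hH (by
    rw [← hTK]; simp only [Matrix.conjTranspose_mul, Matrix.mul_assoc])
  have hof (ω : Ω) : (Matrix.of fun j m => (H ω * (F * T)) m j)ᵀ = H ω * F * T := by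
    ext i j; simp [Matrix.mul_assoc]
  have hgram (ω : Ω) : (H ω * F * T)ᴴ * (H ω * F * T) = Tᴴ * ((H ω * F)ᴴ * (H ω * F)) * T := by
    simp only [Matrix.conjTranspose_mul, Matrix.mul_assoc]
  have hTdet := (Matrix.isUnit_iff_isUnit_det _).1 hT
  -- The Gram inverse is `T * (whitened Gram)⁻¹ * Tᴴ`, and row `k` of `T` is `√x e_k`, so the
  -- diagonal entry only picks up the factor `x`.
  have hentry (ω : Ω) : (((H ω * F)ᴴ * (H ω * F))⁻¹ k k).re =
      x * (((H ω * F * T)ᴴ * (H ω * F * T))⁻¹ k k).re := by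
    have h1 : ((H ω * F)ᴴ * (H ω * F))⁻¹ =
        T * ((H ω * F * T)ᴴ * (H ω * F * T))⁻¹ * Tᴴ := by
      rw [hgram, Matrix.mul_inv_rev, Matrix.mul_inv_rev, ← Matrix.mul_assoc T,
        Matrix.mul_nonsing_inv _ hTdet, Matrix.one_mul, Matrix.mul_assoc,
        Matrix.nonsing_inv_mul _ ((Matrix.isUnit_iff_isUnit_det Tᴴ).1 hT.star), Matrix.mul_one]
    have hs : (√x : ℝ) * √x = x := Real.mul_self_sqrt hx.le
    rw [h1, Matrix.mul_apply]
    simp only [Matrix.mul_apply (M := T), Matrix.conjTranspose_apply, hTk]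
    simp only [ite_mul, zero_mul, Finset.sum_ite_eq', Finset.mem_univ, if_true, RCLike.star_def,
      apply_ite (starRingEnd ℂ), map_zero, mul_ite, mul_zero, Complex.conj_ofReal]
    rw [mul_right_comm, ← Complex.ofReal_mul, hs, Complex.re_ofReal_mul]
  constructor
  · have hLI := ae_linearIndependent_pi_stdComplexGaussian (n := Nr) Nt hN
    rw [← hlaw.map_eq] at hLI
    filter_upwards [ae_of_ae_map hlaw.aemeasurable hLI] with ω hω
    have h1 := isUnit_conjTranspose_mul_self_of_linearIndependent hω
    rw [hof, hgram] at h1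
    exact isUnit_of_mul_isUnit_right (isUnit_of_mul_isUnit_left h1)
  · intro t ht
    obtain ⟨d, rfl⟩ : ∃ d, Nt = d + 1 := ⟨Nt - 1, by omega⟩
    have h := lintegral_exp_neg_mul_inv_gram_inv hN k (div_nonneg ht hx.le)
    have hm : Measurable fun g : Fin (d + 1) → Fin Nr → ℂ => ENNReal.ofReal (Real.exp
        (-(t / x * (((Matrix.of g)ᵀᴴ * (Matrix.of g)ᵀ)⁻¹ k k).re⁻¹))) := by
      have h1 (i j) : Measurable fun g : Fin (d + 1) → Fin Nr → ℂ => (Matrix.of g)ᵀ i j := by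
        simp only [Matrix.transpose_apply, Matrix.of_apply]; fun_prop
      have := measurable_matrix_inv
        (measurable_matrix_mul (measurable_matrix_conjTranspose h1) h1) k k
      exact (Real.measurable_exp.comp
        ((Complex.measurable_re.comp this).inv.const_mul _).neg).ennreal_ofReal
    rw [← hlaw.lintegral_comp hm.aemeasurable] at h
    simp only [hof] at h
    rw [show Nr - (d + 1) + 1 = Nr - d by omega, ← h]
    refine lintegral_congr fun ω => ?_
    rw [hentry, mul_inv, div_mul_eq_mul_div, mul_div_assoc, div_eq_inv_mul]

end Whitening

/-! ### Gaussian scale mixtures and star-shaped regions. -/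

section ScaleMixture

/-- The law of `r * z` with independent `r` of law `τ` and `z` standard complex Gaussian. -/
noncomputable def scaleMixture (τ : Measure ℝ) : Measure ℂ :=
  (τ.prod stdComplexGaussian).map fun p => (p.1 : ℂ) * p.2

variable {τ : Measure ℝ}

instance [IsProbabilityMeasure τ] : IsProbabilityMeasure (scaleMixture τ) :=
  Measure.isProbabilityMeasure_map (by fun_prop)

lemma scaleMixture_apply [SFinite τ] {E : Set ℂ} (hE : MeasurableSet E) :
    scaleMixture τ E = ∫⁻ r, stdComplexGaussian {z | (r : ℂ) * z ∈ E} ∂τ := by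
  have hm : Measurable fun p : ℝ × ℂ => (p.1 : ℂ) * p.2 := by fun_prop
  rw [scaleMixture, Measure.map_apply hm hE, Measure.prod_apply (hm hE)]
  rfl

/-- Used to discard decision ties and the real axis. -/
lemma scaleMixture_absolutelyContinuous [SFinite τ] (hτ : ∀ᵐ r ∂τ, 0 < r) : scaleMixture τ ≪ volume := by
  refine Measure.AbsolutelyContinuous.mk fun E hE h0 => ?_
  rw [scaleMixture_apply hE, lintegral_eq_zero_iff']
  · filter_upwards [hτ] with r hr
    refine stdComplexGaussian_absolutelyContinuous ?_
    have := Measure.addHaar_preimage_smul (volume : Measure ℂ) hr.ne' E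
    rw [h0, mul_zero] at this
    simpa [Set.preimage] using this
  · have hm : Measurable fun p : ℝ × ℂ => (p.1 : ℂ) * p.2 := by fun_prop
    exact (measurable_measure_prodMk_left (hm hE)).aemeasurable

lemma scaleMixture_map_isometry [SFinite τ] (e : ℂ ≃ₗᵢ[ℝ] ℂ) :
    (scaleMixture τ).map e = scaleMixture τ := by
  refine Measure.ext fun E hE => ?_
  have he := e.continuous.measurable
  rw [Measure.map_apply he hE, scaleMixture_apply (he hE), scaleMixture_apply hE]
  refine lintegral_congr fun r => ?_
  have hm : Measurable fun z : ℂ => (r : ℂ) * z := by fun_prop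
  have h := Measure.map_apply (μ := stdComplexGaussian) he (hm hE)
  rw [stdComplexGaussian_map_isometry] at h
  refine Eq.trans ?_ h.symm
  congr 1
  ext z
  have : e ((r : ℂ) * z) = (r : ℂ) * e z := by
    rw [← Complex.real_smul, ← Complex.real_smul, map_smul]
  simp [this]

lemma scaleMixture_preimage_isometry [SFinite τ] (e : ℂ ≃ₗᵢ[ℝ] ℂ) {E : Set ℂ} (hE : MeasurableSet E) :
    scaleMixture τ (e ⁻¹' E) = scaleMixture τ E := by
  conv_rhs => rw [← scaleMixture_map_isometry e, Measure.map_apply e.continuous.measurable hE]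

lemma lintegral_Ioi_mul_exp_neg_sq (a : ℝ) (ha : 0 ≤ a) :
    ∫⁻ s in Set.Ioi a, ENNReal.ofReal (s * Real.exp (-s ^ 2)) =
      ENNReal.ofReal (Real.exp (-a ^ 2) / 2) := by
  have hderiv (s : ℝ) (_ : s ∈ Set.Ici a) :
      HasDerivAt (fun s => -(Real.exp (-s ^ 2) / 2)) (s * Real.exp (-s ^ 2)) s := by
    have h := (((hasDerivAt_pow 2 s).neg.exp).div_const 2).neg
    refine h.congr_deriv ?_
    simp only [Pi.neg_apply]
    push_cast
    ring
  have hpos (s : ℝ) (hs : s ∈ Set.Ioi a) : 0 ≤ s * Real.exp (-s ^ 2) :=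
    mul_nonneg (ha.trans (le_of_lt hs)) (Real.exp_pos _).le
  have hlim : Filter.Tendsto (fun s : ℝ => -(Real.exp (-s ^ 2) / 2)) Filter.atTop (nhds 0) := by
    have h1 : Filter.Tendsto (fun s : ℝ => Real.exp (-s ^ 2)) Filter.atTop (nhds 0) :=
      Real.tendsto_exp_neg_atTop_nhds_zero.comp (Filter.tendsto_pow_atTop two_ne_zero)
    simpa using (h1.div_const 2).neg
  have hint := integrableOn_Ioi_deriv_of_nonneg' hderiv hpos hlim
  rw [← ofReal_integral_eq_lintegral_ofReal hint
    ((ae_restrict_iff' measurableSet_Ioi).2 (.of_forall hpos)),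
    integral_Ioi_of_hasDerivAt_of_tendsto' hderiv hint hlim]
  simp

/-- The region outside a star-shaped boundary, described in polar coordinates. -/
def starRegion (I : Set ℝ) (h : ℝ → ℝ) (d : ℝ) : Set ℂ :=
  {z | z.arg ∈ I ∧ d < ‖z‖ * h z.arg}

lemma measurableSet_starRegion {I : Set ℝ} (hI : MeasurableSet I) {h : ℝ → ℝ} (hh : Measurable h)
    (d : ℝ) : MeasurableSet (starRegion I h d) :=
  (Complex.measurable_arg hI).inter (measurableSet_lt (by fun_prop)
    (measurable_norm.mul (hh.comp Complex.measurable_arg)))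

/-- Along the ray of angle `φ` the region starts at radius `d / (r * h φ)`, and the Gaussian radial
integral beyond it has a closed form. This is the geometric content of Craig's formula. -/
lemma stdComplexGaussian_smul_starRegion {I : Set ℝ} (hI : MeasurableSet I)
    (hIs : I ⊆ Set.Ioo (-Real.pi) Real.pi) {h : ℝ → ℝ} (hh : Measurable h)
    (hpos : ∀ φ ∈ I, 0 < h φ) {d : ℝ} (hd : 0 ≤ d) {r : ℝ} (hr : 0 < r) :
    stdComplexGaussian {z | (r : ℂ) * z ∈ starRegion I h d} =
      ∫⁻ φ in I, ENNReal.ofReal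
        ((2 * Real.pi)⁻¹ * Real.exp (-(d ^ 2 / h φ ^ 2 / r ^ 2))) := by
  have hE : {z | (r : ℂ) * z ∈ starRegion I h d} = starRegion I (fun φ => r * h φ) d := by
    ext z
    simp only [starRegion, Set.mem_ofPred_eq, Complex.arg_real_mul z hr, norm_mul,
      Complex.norm_real, Real.norm_eq_abs, abs_of_pos hr]
    rw [mul_comm r ‖z‖, mul_assoc]
  have hEm := measurableSet_starRegion hI (hh.const_mul r) d
  rw [hE, stdComplexGaussian_eq_withDensity, withDensity_apply _ hEm,
    ← lintegral_indicator hEm, ← Complex.lintegral_comp_polarCoord_symm, polarCoord_target,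
    Measure.volume_eq_prod, ← Measure.prod_restrict, lintegral_prod_symm]
  · rw [← lintegral_indicator measurableSet_Ioo, ← lintegral_indicator hI]
    refine lintegral_congr fun φ => ?_
    by_cases hφ : φ ∈ Set.Ioo (-Real.pi) Real.pi
    swap
    · rw [Set.indicator_of_notMem hφ, Set.indicator_of_notMem fun h => hφ (hIs h)]
    rw [Set.indicator_of_mem hφ]
    have hpolar (s : ℝ) (hs : 0 < s) :
        (Complex.polarCoord.symm (s, φ)).arg = φ ∧ ‖Complex.polarCoord.symm (s, φ)‖ = s := by
      refine ⟨?_, by rw [Complex.norm_polarCoord_symm, abs_of_pos hs]⟩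
      rw [Complex.polarCoord_symm_apply]
      have := Complex.arg_mul_cos_add_sin_mul_I hs ⟨hφ.1, hφ.2.le⟩
      push_cast
      exact this
    by_cases hφI : φ ∈ I
    · rw [Set.indicator_of_mem hφI]
      set a := d / (r * h φ) with ha
      have hrh : 0 < r * h φ := mul_pos hr (hpos φ hφI)
      have ha0 : 0 ≤ a := div_nonneg hd hrh.le
      have hsub : Set.Ioi a ⊆ Set.Ioi 0 := Set.Ioi_subset_Ioi ha0
      have hval : ∀ s ∈ Set.Ioi (0 : ℝ), ENNReal.ofReal s •
          (starRegion I (fun φ => r * h φ) d).indicator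
            (fun z : ℂ => ENNReal.ofReal (Real.pi⁻¹ * Real.exp (-‖z‖ ^ 2)))
            (Complex.polarCoord.symm (s, φ)) =
          (Set.Ioi a).indicator
            (fun s => ENNReal.ofReal Real.pi⁻¹ * ENNReal.ofReal (s * Real.exp (-s ^ 2))) s := by
        intro s hs
        obtain ⟨h1, h2⟩ := hpolar s hs
        have hiff : Complex.polarCoord.symm (s, φ) ∈ starRegion I (fun φ => r * h φ) d ↔
            s ∈ Set.Ioi a := by
          simp only [starRegion, Set.mem_ofPred_eq, h1, h2, hφI, true_and, Set.mem_Ioi, ha]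
          rw [div_lt_iff₀ hrh]
        by_cases hsa : s ∈ Set.Ioi a
        · rw [Set.indicator_of_mem hsa, Set.indicator_of_mem (hiff.2 hsa), h2, smul_eq_mul,
            ← ENNReal.ofReal_mul (le_of_lt hs), ← ENNReal.ofReal_mul (by positivity)]
          ring_nf
        · rw [Set.indicator_of_notMem hsa, Set.indicator_of_notMem fun h => hsa (hiff.1 h),
            smul_zero]
      rw [setLIntegral_congr_fun measurableSet_Ioi hval, lintegral_indicator measurableSet_Ioi,
        Measure.restrict_restrict measurableSet_Ioi, Set.inter_eq_left.2 hsub,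
        lintegral_const_mul _ (by fun_prop), lintegral_Ioi_mul_exp_neg_sq a ha0,
        ← ENNReal.ofReal_mul (by positivity), ha, div_pow, mul_pow]
      congr 1
      rw [mul_inv, div_eq_mul_inv (Real.exp _)]
      have : -(d ^ 2 / (r ^ 2 * h φ ^ 2)) = -(d ^ 2 / h φ ^ 2 / r ^ 2) := by
        rw [div_div, mul_comm (r ^ 2)]
      rw [this]; ring
    · rw [Set.indicator_of_notMem hφI, setLIntegral_congr_fun (g := 0) measurableSet_Ioi]
      · simp
      · intro s hs
        obtain ⟨h1, h2⟩ := hpolar s hs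
        have : Complex.polarCoord.symm (s, φ) ∉ starRegion I (fun φ => r * h φ) d := by
          rintro ⟨h3, -⟩
          rw [h1] at h3
          exact hφI h3
        dsimp only
        rw [Set.indicator_of_notMem this, smul_zero, Pi.zero_apply]
  · have hp : Measurable fun p : ℝ × ℝ => Complex.polarCoord.symm p := by
      simp only [Complex.polarCoord_symm_apply]; fun_prop
    refine Measurable.aemeasurable (measurable_fst.ennreal_ofReal.smul ?_)
    refine Measurable.comp (g := (starRegion I (fun φ => r * h φ) d).indicator
      fun z : ℂ => ENNReal.ofReal (Real.pi⁻¹ * Real.exp (-‖z‖ ^ 2))) ?_ hp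
    exact Measurable.indicator (by fun_prop) hEm

/-- By Tonelli the average over `r` moves inside the angular integral, where it is the Laplace
transform `hL` at `t = d² / h φ²`. -/
lemma scaleMixture_starRegion [SFinite τ] {I : Set ℝ} (hI : MeasurableSet I)
    (hIs : I ⊆ Set.Ioo (-Real.pi) Real.pi) {h : ℝ → ℝ} (hh : Measurable h)
    (hpos : ∀ φ ∈ I, 0 < h φ) {d : ℝ} (hd : 0 ≤ d) (hτ : ∀ᵐ r ∂τ, 0 < r) {b : ℝ} {D : ℕ}
    (hb : 0 ≤ b)
    (hL : ∀ t : ℝ, 0 ≤ t → ∫⁻ r, ENNReal.ofReal (Real.exp (-(t / r ^ 2))) ∂τ =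
      ENNReal.ofReal ((1 + t * b)⁻¹ ^ D)) :
    (scaleMixture τ).real (starRegion I h d) =
      ∫ φ in I, (2 * Real.pi)⁻¹ * (1 + d ^ 2 / h φ ^ 2 * b)⁻¹ ^ D := by
  have hval : scaleMixture τ (starRegion I h d) =
      ∫⁻ φ in I, ENNReal.ofReal ((2 * Real.pi)⁻¹ * (1 + d ^ 2 / h φ ^ 2 * b)⁻¹ ^ D) := by
    rw [scaleMixture_apply (measurableSet_starRegion hI hh d)]
    have h1 : ∀ᵐ r : ℝ ∂τ, stdComplexGaussian {z | (r : ℂ) * z ∈ starRegion I h d} =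
        ∫⁻ φ in I, ENNReal.ofReal ((2 * Real.pi)⁻¹ * Real.exp (-(d ^ 2 / h φ ^ 2 / r ^ 2))) := by
      filter_upwards [hτ] with r hr
      exact stdComplexGaussian_smul_starRegion hI hIs hh hpos hd hr
    rw [lintegral_congr_ae h1, lintegral_lintegral_swap (by
      refine Measurable.aemeasurable (Measurable.ennreal_ofReal ?_)
      refine (Real.measurable_exp.comp ?_).const_mul _
      exact ((((hh.comp measurable_snd).pow_const 2).const_div _).div
        (measurable_fst.pow_const 2)).neg)]
    refine lintegral_congr fun φ => ?_
    simp_rw [ENNReal.ofReal_mul (show 0 ≤ (2 * Real.pi)⁻¹ by positivity)]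
    rw [lintegral_const_mul _ (by fun_prop), hL _ (by positivity)]
  have hm : Measurable fun φ => (2 * Real.pi)⁻¹ * (1 + d ^ 2 / h φ ^ 2 * b)⁻¹ ^ D :=
    ((((((hh.pow_const 2).const_div _).mul_const b).const_add 1).inv).pow_const D).const_mul _
  rw [Measure.real, hval, integral_eq_lintegral_of_nonneg_ae (.of_forall fun φ => by positivity)
    hm.aestronglyMeasurable]

end ScaleMixture

/-! ### From the detector to error regions of the noise. -/

section Detection

variable {Ω : Type*} [MeasurableSpace Ω] {μ : Measure Ω}

lemma IsComplexGaussian.hasLaw_dotProduct {n : ℕ} {ξ : Ω → Fin n → ℂ} {σ : ℝ}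
    (hξ : IsComplexGaussian μ ξ (((σ ^ 2 : ℝ) : ℂ) • (1 : Matrix (Fin n) (Fin n) ℂ)))
    (c : Fin n → ℂ) {ρ : ℝ} (hρ : 0 < ρ) (hρc : ρ ^ 2 = σ ^ 2 * ∑ m, ‖c m‖ ^ 2) :
    HasLaw (fun ω => (ρ : ℂ)⁻¹ * (c ⬝ᵥ ξ ω)) stdComplexGaussian μ := by
  have hρ0 : (ρ : ℂ) ≠ 0 := by exact_mod_cast hρ.ne'
  let A : Matrix (Fin 1) (Fin n) ℂ := Matrix.of fun _ m => (ρ : ℂ)⁻¹ * c m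
  have h := hξ.mulVec A
  have hA : A.map (starRingEnd ℂ) * (((σ ^ 2 : ℝ) : ℂ) • (1 : Matrix (Fin n) (Fin n) ℂ)) * Aᵀ
      = 1 := by
    ext i j
    rw [Subsingleton.elim i 0, Subsingleton.elim j 0, Matrix.mul_smul, Matrix.smul_mul,
      Matrix.mul_one, Matrix.smul_apply, Matrix.mul_apply, Matrix.one_apply_eq]
    have h1 (m) : A.map (starRingEnd ℂ) 0 m * Aᵀ m 0 =
        ((ρ : ℂ) ^ 2)⁻¹ * ((‖c m‖ ^ 2 : ℝ) : ℂ) := by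
      simp only [A, Matrix.map_apply, Matrix.transpose_apply, Matrix.of_apply, map_mul, map_inv₀,
        Complex.conj_ofReal]
      rw [Complex.sq_norm, Complex.normSq_eq_conj_mul_self, sq, mul_inv]
      ring
    simp_rw [h1]
    rw [← Finset.mul_sum, smul_eq_mul, ← Complex.ofReal_sum, ← Complex.ofReal_pow, hρc,
      mul_left_comm, ← Complex.ofReal_mul, inv_mul_cancel₀]
    rw [← hρc]
    exact_mod_cast (pow_pos hρ 2).ne'
  rw [hA] at h
  have h2 := (measurePreserving_eval (fun _ : Fin 1 => stdComplexGaussian) 0).comp_hasLaw h.hasLaw_pi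
  convert h2 using 1
  ext ω
  simp [A, Matrix.mulVec, dotProduct, Finset.mul_sum, mul_assoc]

/-- Conditioning on `X = a` leaves a Gaussian of scale `r a`; integrating over the law of `X` gives
the mixture. -/
lemma IndepFun.hasLaw_scaleMixture {α β : Type*} [MeasurableSpace α] [MeasurableSpace β]
    [IsProbabilityMeasure μ] {X : Ω → α} {Y : Ω → β} (hXY : IndepFun X Y μ)
    (hX : AEMeasurable X μ) (hY : AEMeasurable Y μ) {Φ : α × β → ℂ} (hΦ : Measurable Φ)
    {r : α → ℝ} (hr : Measurable r)
    (hlaw : ∀ᵐ a ∂(μ.map X), ∀ E : Set ℂ, MeasurableSet E →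
      (μ.map Y) {b | Φ (a, b) ∈ E} = stdComplexGaussian {z | (r a : ℂ) * z ∈ E}) :
    HasLaw (fun ω => Φ (X ω, Y ω)) (scaleMixture ((μ.map X).map r)) μ where
  aemeasurable := hΦ.comp_aemeasurable (hX.prodMk hY)
  map_eq := by
    have := Measure.isProbabilityMeasure_map hX
    have := Measure.isProbabilityMeasure_map hY
    have := Measure.isProbabilityMeasure_map (μ := μ.map X) hr.aemeasurable
    have h1 := (indepFun_iff_map_prod_eq_prod_map_map hX hY).1 hXY
    have h2 : μ.map (fun ω => Φ (X ω, Y ω)) = ((μ.map X).prod (μ.map Y)).map Φ := by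
      rw [← h1, AEMeasurable.map_map_of_aemeasurable hΦ.aemeasurable (hX.prodMk hY)]
      rfl
    refine Measure.ext fun E hE => ?_
    have hm : Measurable fun p : ℝ × ℂ => (p.1 : ℂ) * p.2 := by fun_prop
    have hm2 : Measurable fun a : ℝ => stdComplexGaussian {z | (a : ℂ) * z ∈ E} :=
      measurable_measure_prodMk_left (hm hE)
    rw [h2, Measure.map_apply hΦ hE, Measure.prod_apply (hΦ hE), scaleMixture_apply hE,
      lintegral_map hm2 hr]
    refine lintegral_congr_ae ?_
    filter_upwards [hlaw] with a ha using ha E hE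

lemma pseudoInverse_mul_self {m n : ℕ} {A : Matrix (Fin m) (Fin n) ℂ} (hA : IsUnit (Aᴴ * A)) :
    pseudoInverse A * A = 1 := by
  rw [pseudoInverse, Matrix.mul_assoc,
    Matrix.nonsing_inv_mul _ ((Matrix.isUnit_iff_isUnit_det _).1 hA)]

/-- The noise gain of stream `k` is a diagonal entry of `A⁺ (A⁺)ᴴ = (AᴴA)⁻¹`. -/
lemma sum_sq_norm_pseudoInverse {m n : ℕ} {A : Matrix (Fin m) (Fin n) ℂ} (hA : IsUnit (Aᴴ * A))
    (k : Fin n) :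
    0 < ((Aᴴ * A)⁻¹ k k).re ∧ ∑ j, ‖pseudoInverse A k j‖ ^ 2 = ((Aᴴ * A)⁻¹ k k).re := by
  have hpd : (Aᴴ * A).PosDef :=
    (Matrix.posSemidef_conjTranspose_mul_self A).posDef_iff_isUnit.2 hA
  refine ⟨(Complex.pos_iff.1 hpd.inv.diag_pos).1, ?_⟩
  have hdet := (Matrix.isUnit_iff_isUnit_det _).1 hA
  have h1 : pseudoInverse A * (pseudoInverse A)ᴴ = (Aᴴ * A)⁻¹ := by
    rw [pseudoInverse, Matrix.conjTranspose_mul, Matrix.conjTranspose_conjTranspose,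
      hpd.isHermitian.inv.eq, Matrix.mul_assoc, ← Matrix.mul_assoc Aᴴ,
      Matrix.mul_nonsing_inv _ hdet, Matrix.mul_one]
  rw [← h1, Matrix.mul_apply, Complex.re_sum]
  refine Finset.sum_congr rfl fun j _ => ?_
  rw [Matrix.conjTranspose_apply, RCLike.star_def, Complex.mul_conj, Complex.ofReal_re,
    Complex.sq_norm]

/-- The noise after zero-forcing is a Gaussian scale mixture whose scale has an explicit Laplace
transform. -/
lemma exists_hasLaw_zf_noise [IsProbabilityMeasure μ] {Nr Nt : ℕ} (hNt : 1 ≤ Nt) (hN : Nt ≤ Nr)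
    {F Sig : Matrix (Fin Nt) (Fin Nt) ℂ} (hF : IsUnit F) (hSig : Sig.PosDef) {σ : ℝ} (hσ : 0 < σ)
    {H : Ω → Matrix (Fin Nr) (Fin Nt) ℂ} {ξ : Ω → Fin Nr → ℂ}
    (hH : IsComplexGaussian μ (fun ω (p : Fin Nr × Fin Nt) => H ω p.1 p.2)
      ((1 : Matrix (Fin Nr) (Fin Nr) ℂ) ⊗ₖ Sig))
    (hξ : IsComplexGaussian μ ξ (((σ ^ 2 : ℝ) : ℂ) • (1 : Matrix (Fin Nr) (Fin Nr) ℂ)))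
    (hind : IndepFun (fun ω (p : Fin Nr × Fin Nt) => H ω p.1 p.2) ξ μ) (k : Fin Nt) :
    ∃ τ : Measure ℝ, IsProbabilityMeasure τ ∧ (∀ᵐ r ∂τ, 0 < r) ∧
      (∀ t : ℝ, 0 ≤ t → ∫⁻ r, ENNReal.ofReal (Real.exp (-(t / r ^ 2))) ∂τ =
        ENNReal.ofReal
          ((1 + t * (1 / σ ^ 2 / ((Fᴴ * Sig * F)⁻¹ k k).re))⁻¹ ^ (Nr - Nt + 1))) ∧
      ∃ Φ : (Fin Nr × Fin Nt → ℂ) × (Fin Nr → ℂ) → ℂ, Measurable Φ ∧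
        (∀ ω, Φ (fun p => H ω p.1 p.2, ξ ω) = (pseudoInverse (H ω * F) *ᵥ ξ ω) k) ∧
        HasLaw (fun ω => Φ (fun p => H ω p.1 p.2, ξ ω)) (scaleMixture τ) μ := by
  obtain ⟨hx, hunit, hL⟩ := channel_gram_inv hNt hN hF hSig hH k
  let A : (Fin Nr × Fin Nt → ℂ) → Matrix (Fin Nr) (Fin Nt) ℂ := fun h =>
    (Matrix.of fun i j => h (i, j)) * F
  have hA (ω) : A (fun p => H ω p.1 p.2) = H ω * F := rfl
  have hAm (i j) : Measurable fun h => A h i j :=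
    measurable_matrix_mul (f := fun h : Fin Nr × Fin Nt → ℂ => Matrix.of fun i j => h (i, j))
      (g := fun _ => F) (fun i j => measurable_pi_apply (i, j)) (fun _ _ => measurable_const) i j
  have hAH := measurable_matrix_conjTranspose hAm
  have hginv := measurable_matrix_inv (measurable_matrix_mul hAH hAm)
  have hpm (i j) : Measurable fun h => pseudoInverse (A h) i j :=
    measurable_matrix_mul hginv hAH i j
  let g : (Fin Nr × Fin Nt → ℂ) → ℝ := fun h => (((A h)ᴴ * A h)⁻¹ k k).re
  have hgm : Measurable g := Complex.measurable_re.comp (hginv k k)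
  -- The scale of the equalized noise given the channel: `r² = σ² g`. Hence `hL` is later used at `t
  -- / σ²`.
  let r : (Fin Nr × Fin Nt → ℂ) → ℝ := fun h => σ * √(g h)
  have hrm : Measurable r := hgm.sqrt.const_mul σ
  have hXm := hH.gaussian.aemeasurable
  let Φ : (Fin Nr × Fin Nt → ℂ) × (Fin Nr → ℂ) → ℂ := fun p => (pseudoInverse (A p.1) *ᵥ p.2) k
  have hΦ : Measurable Φ := by
    simp only [Φ, Matrix.mulVec, dotProduct]
    exact Finset.measurable_fun_sum _ fun m _ =>
      ((hpm k m).comp measurable_fst).mul ((measurable_pi_apply m).comp measurable_snd)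
  have hsetm : MeasurableSet {h | IsUnit ((A h)ᴴ * A h)} := by
    have : {h | IsUnit ((A h)ᴴ * A h)} = {h | ((A h)ᴴ * A h).det ≠ 0} := by
      ext h; simp [Matrix.isUnit_iff_isUnit_det]
    rw [this]
    exact measurable_matrix_det (measurable_matrix_mul hAH hAm) (measurableSet_singleton 0).compl
  have hunit' : ∀ᵐ h ∂(μ.map fun ω (p : Fin Nr × Fin Nt) => H ω p.1 p.2),
      IsUnit ((A h)ᴴ * A h) := (ae_map_iff hXm hsetm).2 hunit
  refine ⟨(μ.map fun ω (p : Fin Nr × Fin Nt) => H ω p.1 p.2).map r, ?_, ?_, ?_,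
    Φ, hΦ, fun ω => rfl, ?_⟩
  · have := Measure.isProbabilityMeasure_map hXm
    exact Measure.isProbabilityMeasure_map hrm.aemeasurable
  · refine (ae_map_iff hrm.aemeasurable measurableSet_Ioi).2 ?_
    filter_upwards [hunit'] with h hh
    exact mul_pos hσ (Real.sqrt_pos.2 (sum_sq_norm_pseudoInverse hh k).1)
  · intro t ht
    have hem : Measurable fun a : ℝ => ENNReal.ofReal (Real.exp (-(t / a ^ 2))) := by fun_prop
    have hcomp := lintegral_map' (hem.comp hrm).aemeasurable hXm
    simp only [Function.comp_apply] at hcomp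
    rw [lintegral_map hem hrm, hcomp]
    have := hL (t / σ ^ 2) (by positivity)
    rw [show t * (1 / σ ^ 2 / ((Fᴴ * Sig * F)⁻¹ k k).re) =
      t / σ ^ 2 / ((Fᴴ * Sig * F)⁻¹ k k).re by ring, ← this]
    refine lintegral_congr_ae ?_
    filter_upwards [hunit] with ω hω
    have hpos := (sum_sq_norm_pseudoInverse hω k).1
    have h1 : r (fun p => H ω p.1 p.2) ^ 2 = σ ^ 2 * (((H ω * F)ᴴ * (H ω * F))⁻¹ k k).re := by
      simp only [r, g, hA, mul_pow]
      rw [Real.sq_sqrt hpos.le]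
    rw [h1, ← div_div, div_eq_mul_inv (t / σ ^ 2)]
  · refine IndepFun.hasLaw_scaleMixture hind hXm hξ.gaussian.aemeasurable hΦ hrm ?_
    filter_upwards [hunit'] with h hh E hE
    obtain ⟨hpos, hsum⟩ := sum_sq_norm_pseudoInverse hh k
    have hr : 0 < r h := mul_pos hσ (Real.sqrt_pos.2 hpos)
    have hl := hξ.hasLaw_dotProduct (pseudoInverse (A h) k) hr (by
      rw [hsum, mul_pow, Real.sq_sqrt hpos.le])
    have hEm : MeasurableSet {z : ℂ | (r h : ℂ) * z ∈ E} :=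
      (measurable_const_mul (r h : ℂ)) hE
    have hEm2 : MeasurableSet {b | Φ (h, b) ∈ E} := (hΦ.comp measurable_prodMk_left) hE
    rw [← hl.map_eq, Measure.map_apply_of_aemeasurable hl.aemeasurable hEm,
      Measure.map_apply_of_aemeasurable hξ.gaussian.aemeasurable hEm2]
    congr 1
    ext ω
    have hr0 : (r h : ℂ) ≠ 0 := by exact_mod_cast hr.ne'
    simp only [Set.mem_preimage, Set.mem_ofPred_eq, mul_inv_cancel_left₀ hr0]
    rfl

/-- The noise values for which the symbol `a` is confused with another point of `S`. -/
def errorRegion (S : Set ℂ) (a : ℂ) : Set ℂ := {z | ∃ b ∈ S, ‖a + z - b‖ < ‖z‖}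

/-- The tie set is the perpendicular bisector of `0` and `b - a`, a proper affine subspace. -/
lemma volume_setOf_norm_add_sub_eq {a b : ℂ} (hab : a ≠ b) :
    volume {z : ℂ | ‖a + z - b‖ = ‖z‖} = 0 := by
  have h := Measure.addHaar_affineSubspace (volume : Measure ℂ)
    (AffineSubspace.perpBisector (b - a) 0)
    (by rw [ne_eq, AffineSubspace.perpBisector_eq_top, sub_eq_zero]; exact hab.symm)
  convert h using 2
  ext z
  rw [SetLike.mem_coe, AffineSubspace.mem_perpBisector_iff_dist_eq, dist_eq_norm, dist_zero_right,
    Set.mem_ofPred_eq, show a + z - b = z - (b - a) by ring]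

lemma lintegral_uniformOn_range {ι : Type*} [Fintype ι] {f : ι → ℂ} (hf : Function.Injective f)
    (g : ℂ → ENNReal) :
    ∫⁻ a, g a ∂(uniformOn (Set.range f)) = (Fintype.card ι : ENNReal)⁻¹ * ∑ i, g (f i) := by
  classical
  have hS : Set.range f = ((Finset.univ.image f : Finset ℂ) : Set ℂ) := by simp
  rw [hS, uniformOn, ProbabilityTheory.cond, lintegral_smul_measure, lintegral_finset,
    Finset.sum_image hf.injOn, Measure.count_apply_finset, Finset.card_image_of_injective _ hf,
    Finset.card_univ, smul_eq_mul]
  simp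

/-- The symbol error probability of one stream is the average over the constellation of the
probability that the noise falls into the error region. -/
lemma exists_symbolErrorProb_eq [IsProbabilityMeasure μ] {Nr Nt : ℕ} (hNt : 1 ≤ Nt) (hN : Nt ≤ Nr)
    {F Sig : Matrix (Fin Nt) (Fin Nt) ℂ} (hF : IsUnit F) (hSig : Sig.PosDef) {σ : ℝ} (hσ : 0 < σ)
    {H : Ω → Matrix (Fin Nr) (Fin Nt) ℂ} {ξ : Ω → Fin Nr → ℂ} {s sHat : Ω → Fin Nt → ℂ}
    {ι : Type*} [Fintype ι] {f : ι → ℂ} (hf : Function.Injective f)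
    (hsys : IsZFSystem μ (Set.range f) F Sig σ H ξ s sHat) (k : Fin Nt) :
    ∃ τ : Measure ℝ, IsProbabilityMeasure τ ∧ (∀ᵐ r ∂τ, 0 < r) ∧
      (∀ t : ℝ, 0 ≤ t → ∫⁻ r, ENNReal.ofReal (Real.exp (-(t / r ^ 2))) ∂τ =
        ENNReal.ofReal
          ((1 + t * (1 / σ ^ 2 / ((Fᴴ * Sig * F)⁻¹ k k).re))⁻¹ ^ (Nr - Nt + 1))) ∧
      μ.real {ω | sHat ω k ≠ s ω k} = (Fintype.card ι : ℝ)⁻¹ *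
        ∑ i, (scaleMixture τ).real (errorRegion (Set.range f) (f i)) := by
  obtain ⟨τ, hτ, hpos, hL, Φ, hΦ, hΦω, hZ⟩ :=
    exists_hasLaw_zf_noise hNt hN hF hSig hσ hsys.channel hsys.noise hsys.channel_indep_noise k
  refine ⟨τ, hτ, hpos, hL, ?_⟩
  set Z : Ω → ℂ := fun ω => Φ (fun p => H ω p.1 p.2, ξ ω) with hZdef
  have hindep : IndepFun (fun ω => s ω k) Z μ :=
    (hsys.symbols_indep_channel_noise.comp hΦ (measurable_pi_apply k)).symm
  have hlaw := (indepFun_iff_hasLaw_prodMk_prod (hsys.symbols_uniform k) hZ).1 hindep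
  have hunit := (channel_gram_inv hNt hN hF hSig hsys.channel k).2.1
  have hr : ∀ᵐ ω ∂μ, zfEqualize F (H ω) (receivedSignal F (H ω) (s ω) (ξ ω)) k =
      s ω k + Z ω := by
    filter_upwards [hunit] with ω hω
    rw [zfEqualize, receivedSignal, Matrix.mulVec_add, Matrix.mulVec_mulVec,
      pseudoInverse_mul_self hω, Matrix.one_mulVec, Pi.add_apply, hZdef]
    dsimp only
    rw [hΦω]
  have hsS : ∀ᵐ ω ∂μ, s ω k ∈ Set.range f := by
    have hm : MeasurableSet (Set.range f) := (Set.finite_range f).measurableSet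
    have := (hsys.symbols_uniform k).ae_iff (p := fun a => a ∈ Set.range f)
      hm.mem
    rw [this]
    exact ae_cond_mem hm
  have htie : ∀ᵐ ω ∂μ, ∀ i j, f i ≠ f j → ‖f i + Z ω - f j‖ ≠ ‖Z ω‖ := by
    refine ae_all_iff.2 fun i => ae_all_iff.2 fun j => ?_
    by_cases hij : f i = f j
    · exact .of_forall fun ω h => absurd hij h
    · have h0 := scaleMixture_absolutelyContinuous hpos (volume_setOf_norm_add_sub_eq hij)
      rw [← hZ.map_eq] at h0
      have h1 := ae_of_ae_map hZ.aemeasurable (measure_eq_zero_iff_ae_notMem.1 h0)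
      filter_upwards [h1] with ω hω _ using hω
  let B : Set (ℂ × ℂ) := {p | p.2 ∈ errorRegion (Set.range f) p.1}
  have hB : MeasurableSet B := by
    have : B = ⋃ i, {p : ℂ × ℂ | ‖p.1 + p.2 - f i‖ < ‖p.2‖} := by
      ext p; simp [B, errorRegion]
    rw [this]
    exact MeasurableSet.iUnion fun i => measurableSet_lt (by fun_prop) (by fun_prop)
  -- Away from ties, a wrong decision means that some other point is strictly closer, whatever the
  -- tie-breaking rule. This identification up to a null set also avoids any measurability of
  -- `sHat`.
  have heq : {ω | sHat ω k ≠ s ω k} =ᵐ[μ] (fun ω => (s ω k, Z ω)) ⁻¹' B := by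
    filter_upwards [hr, hsS, htie] with ω h1 ⟨i, hi⟩ h3
    obtain ⟨⟨j, hj⟩, hmin⟩ := hsys.detection ω k
    rw [h1] at hmin
    refine propext ⟨fun hne => ?_, ?_⟩
    · change sHat ω k ≠ s ω k at hne
      refine ⟨sHat ω k, ⟨j, hj⟩, ?_⟩
      have h4 := hmin (s ω k) ⟨i, hi⟩
      rw [add_sub_cancel_left] at h4
      have h5 := le_of_sq_le_sq h4 (norm_nonneg _)
      refine lt_of_le_of_ne h5 ?_
      have := h3 i j (by rw [hi, hj]; exact hne.symm)
      rwa [hi, hj] at this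
    · rintro ⟨b, hb, hlt⟩ h
      have h4 := hmin b hb
      rw [h, add_sub_cancel_left] at h4
      exact absurd (le_of_sq_le_sq h4 (norm_nonneg _)) (not_le.2 hlt)
  rw [Measure.real, measure_congr heq, ← Measure.map_apply_of_aemeasurable hlaw.aemeasurable hB,
    hlaw.map_eq, Measure.prod_apply hB, lintegral_uniformOn_range hf, ENNReal.toReal_mul,
    ENNReal.toReal_inv, ENNReal.toReal_natCast, ENNReal.toReal_sum fun i _ => measure_ne_top _ _]
  rfl

end Detection

/-! ### Elementary properties of the integrand. -/

section CraigIntegrand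

variable {Nr Nt : ℕ}

lemma craigIntegrand_eq (hN : Nt ≤ Nr) (c x θ : ℝ) :
    craigIntegrand Nr Nt c x θ = (1 + c / (x * Real.sin θ ^ 2))⁻¹ ^ (Nr - Nt + 1) := by
  have : (-((Nr : ℤ) - (Nt : ℤ) + 1)) = -((Nr - Nt + 1 : ℕ) : ℤ) := by push_cast [hN]; ring
  rw [craigIntegrand, this, zpow_neg, zpow_natCast, inv_pow]

lemma craigIntegrand_nonneg (hN : Nt ≤ Nr) {c x : ℝ} (hc : 0 ≤ c) (hx : 0 ≤ x) (θ : ℝ) :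
    0 ≤ craigIntegrand Nr Nt c x θ := by
  rw [craigIntegrand_eq hN]; positivity

lemma craigIntegrand_le_one (hN : Nt ≤ Nr) {c x : ℝ} (hc : 0 ≤ c) (hx : 0 ≤ x) (θ : ℝ) :
    craigIntegrand Nr Nt c x θ ≤ 1 := by
  rw [craigIntegrand_eq hN]
  refine pow_le_one₀ (by positivity) (inv_le_one_of_one_le₀ ?_)
  have : 0 ≤ c / (x * Real.sin θ ^ 2) := by positivity
  linarith

lemma intervalIntegrable_craigIntegrand (hN : Nt ≤ Nr) {c x : ℝ} (hc : 0 ≤ c) (hx : 0 ≤ x)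
    (a b : ℝ) : IntervalIntegrable (craigIntegrand Nr Nt c x) volume a b := by
  have hm : Measurable (craigIntegrand Nr Nt c x) := by
    rw [funext (craigIntegrand_eq hN c x)]
    exact (((((Real.measurable_sin.pow_const 2).const_mul x).const_div c).const_add 1).inv).pow_const
      _
  refine (intervalIntegrable_const (c := (1 : ℝ))).mono_fun hm.aestronglyMeasurable ?_
  refine .of_forall fun θ => ?_
  dsimp only
  rw [Real.norm_of_nonneg (craigIntegrand_nonneg hN hc hx θ), norm_one]
  exact craigIntegrand_le_one hN hc hx θ

lemma craigIntegrand_pi_sub (c x θ : ℝ) :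
    craigIntegrand Nr Nt c x (Real.pi - θ) = craigIntegrand Nr Nt c x θ := by
  simp [craigIntegrand]

lemma craigIntegrand_cos (hN : Nt ≤ Nr) (d η x φ : ℝ) :
    (1 + d ^ 2 / Real.cos φ ^ 2 * (η / x))⁻¹ ^ (Nr - Nt + 1) =
      craigIntegrand Nr Nt (d ^ 2 * η) x (Real.pi / 2 - φ) := by
  rw [craigIntegrand_eq hN, Real.sin_pi_div_two_sub, div_mul_div_comm,
    mul_comm (Real.cos φ ^ 2) x]

lemma craigIntegrand_sin (hN : Nt ≤ Nr) (d η x φ : ℝ) :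
    (1 + d ^ 2 / Real.sin φ ^ 2 * (η / x))⁻¹ ^ (Nr - Nt + 1) =
      craigIntegrand Nr Nt (d ^ 2 * η) x φ := by
  rw [craigIntegrand_eq hN, div_mul_div_comm, mul_comm (Real.sin φ ^ 2) x]

end CraigIntegrand

/-! ### Half-planes and quadrants. -/

section HalfPlane

variable {Nr Nt : ℕ} {τ : Measure ℝ} {η x d : ℝ}

/-- Craig's formula, averaged over the scale: the probability of a half-plane. -/
lemma scaleMixture_halfPlane [SFinite τ] (hN : Nt ≤ Nr) (hη : 0 ≤ η) (hx : 0 < x)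
    (hτ : ∀ᵐ r ∂τ, 0 < r)
    (hL : ∀ t : ℝ, 0 ≤ t → ∫⁻ r, ENNReal.ofReal (Real.exp (-(t / r ^ 2))) ∂τ =
      ENNReal.ofReal ((1 + t * (η / x))⁻¹ ^ (Nr - Nt + 1))) (hd : 0 < d) :
    (scaleMixture τ).real {z | d < z.re} =
      Real.pi⁻¹ * ∫ θ in (0 : ℝ)..(Real.pi / 2), craigIntegrand Nr Nt (d ^ 2 * η) x θ := by
  have hpi := Real.pi_pos
  have hset : {z : ℂ | d < z.re} =
      starRegion (Set.Ioo (-(Real.pi / 2)) (Real.pi / 2)) Real.cos d := by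
    ext z
    simp only [starRegion, Set.mem_ofPred_eq, Complex.norm_mul_cos_arg]
    refine ⟨fun h => ⟨?_, h⟩, fun h => h.2⟩
    exact abs_lt.1 (Complex.abs_arg_lt_pi_div_two_iff.2 (Or.inl (hd.trans h)))
  have hc : 0 ≤ d ^ 2 * η := by positivity
  have hi := intervalIntegrable_craigIntegrand hN hc hx.le
  rw [hset, scaleMixture_starRegion measurableSet_Ioo
    (Set.Ioo_subset_Ioo (by linarith) (by linarith)) Real.measurable_cos
    (fun φ hφ => Real.cos_pos_of_mem_Ioo hφ) hd.le hτ (div_nonneg hη hx.le) hL]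
  simp_rw [craigIntegrand_cos hN]
  rw [← integral_Ioc_eq_integral_Ioo, ← intervalIntegral.integral_of_le (by linarith),
    intervalIntegral.integral_const_mul,
    intervalIntegral.integral_comp_sub_left (craigIntegrand Nr Nt (d ^ 2 * η) x),
    show Real.pi / 2 - Real.pi / 2 = 0 by ring, show Real.pi / 2 - -(Real.pi / 2) = Real.pi by ring,
    ← intervalIntegral.integral_add_adjacent_intervals (hi 0 (Real.pi / 2)) (hi _ _)]
  -- After `θ = π/2 - φ` the range is `[0, π]`. The reflection `θ ↦ π - θ` makes its halves equal,
  -- turning `1 / (2π)` into `1 / π`.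
  have h2 := intervalIntegral.integral_comp_sub_left (craigIntegrand Nr Nt (d ^ 2 * η) x) Real.pi
    (a := 0) (b := Real.pi / 2)
  simp_rw [craigIntegrand_pi_sub] at h2
  rw [sub_zero, show Real.pi - Real.pi / 2 = Real.pi / 2 by ring] at h2
  rw [← h2, mul_inv]
  ring

/-- Craig's formula for a quadrant, averaged over the scale. -/
lemma scaleMixture_quadrant [SFinite τ] (hN : Nt ≤ Nr) (hη : 0 ≤ η) (hx : 0 < x)
    (hτ : ∀ᵐ r ∂τ, 0 < r)
    (hL : ∀ t : ℝ, 0 ≤ t → ∫⁻ r, ENNReal.ofReal (Real.exp (-(t / r ^ 2))) ∂τ =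
      ENNReal.ofReal ((1 + t * (η / x))⁻¹ ^ (Nr - Nt + 1))) (hd : 0 < d) :
    (scaleMixture τ).real {z | d < z.re ∧ d < z.im} =
      Real.pi⁻¹ * ∫ θ in (0 : ℝ)..(Real.pi / 4), craigIntegrand Nr Nt (d ^ 2 * η) x θ := by
  have hpi := Real.pi_pos
  have hset : {z : ℂ | d < z.re ∧ d < z.im} =
      starRegion (Set.Ioo 0 (Real.pi / 2)) (fun φ => min (Real.cos φ) (Real.sin φ)) d := by
    ext z
    simp only [starRegion, Set.mem_ofPred_eq, mul_min_of_nonneg _ _ (norm_nonneg z),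
      Complex.norm_mul_cos_arg, Complex.norm_mul_sin_arg, lt_min_iff]
    refine ⟨fun h => ⟨⟨?_, ?_⟩, h⟩, fun h => h.2⟩
    · refine lt_of_le_of_ne (Complex.arg_nonneg_iff.2 (hd.trans h.2).le) fun h0 => ?_
      have := (Complex.arg_eq_zero_iff.1 h0.symm).2
      linarith [h.2]
    · exact (abs_lt.1 (Complex.abs_arg_lt_pi_div_two_iff.2 (Or.inl (hd.trans h.1)))).2
  have hc : 0 ≤ d ^ 2 * η := by positivity
  have hi := intervalIntegrable_craigIntegrand hN hc hx.le
  rw [hset, scaleMixture_starRegion measurableSet_Ioo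
    (Set.Ioo_subset_Ioo (by linarith) (by linarith)) (Real.measurable_cos.min Real.measurable_sin)
    (fun φ hφ => lt_min (Real.cos_pos_of_mem_Ioo ⟨by linarith [hφ.1], hφ.2⟩)
      (Real.sin_pos_of_pos_of_lt_pi hφ.1 (by linarith [hφ.2]))) hd.le hτ
      (div_nonneg hη hx.le) hL]
  rw [← integral_Ioc_eq_integral_Ioo, ← intervalIntegral.integral_of_le (by linarith),
    intervalIntegral.integral_const_mul]
  set g : ℝ → ℝ := fun φ =>
    (1 + d ^ 2 / min (Real.cos φ) (Real.sin φ) ^ 2 * (η / x))⁻¹ ^ (Nr - Nt + 1) with hg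
  -- The minimum is the sine below `π/4` and the cosine above; `φ ↦ π/2 - φ` carries the second half
  -- onto the first.
  have h1 : Set.EqOn (craigIntegrand Nr Nt (d ^ 2 * η) x) g (Set.uIcc 0 (Real.pi / 4)) := by
    intro φ hφ
    rw [Set.uIcc_of_le (by linarith)] at hφ
    have : Real.sin φ ≤ Real.cos φ := by
      rw [← Real.sin_pi_div_two_sub]
      exact Real.sin_le_sin_of_le_of_le_pi_div_two (by linarith [hφ.1]) (by linarith [hφ.1])
        (by linarith [hφ.2])
    simp only [hg, min_eq_right this, craigIntegrand_sin hN]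
  have h2 : Set.EqOn (fun φ => craigIntegrand Nr Nt (d ^ 2 * η) x (Real.pi / 2 - φ)) g
      (Set.uIcc (Real.pi / 4) (Real.pi / 2)) := by
    intro φ hφ
    rw [Set.uIcc_of_le (by linarith)] at hφ
    have : Real.cos φ ≤ Real.sin φ := by
      rw [← Real.sin_pi_div_two_sub]
      exact Real.sin_le_sin_of_le_of_le_pi_div_two (by linarith [hφ.2]) hφ.2 (by linarith [hφ.1])
    simp only [hg, min_eq_left this, craigIntegrand_cos hN]
  have hi2 := (hi (Real.pi / 2 - Real.pi / 4) (Real.pi / 2 - Real.pi / 2)).comp_sub_left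
    (Real.pi / 2)
  simp only [sub_sub_cancel] at hi2
  rw [← intervalIntegral.integral_add_adjacent_intervals
      ((hi 0 (Real.pi / 4)).congr fun φ hφ => h1 (Set.uIoc_subset_uIcc hφ))
      (hi2.congr fun φ hφ => h2 (Set.uIoc_subset_uIcc hφ)),
    ← intervalIntegral.integral_congr h1, ← intervalIntegral.integral_congr h2,
    intervalIntegral.integral_comp_sub_left (craigIntegrand Nr Nt (d ^ 2 * η) x), sub_self,
    show Real.pi / 2 - Real.pi / 4 = Real.pi / 4 by ring, mul_inv]
  ring

end HalfPlane

/-! ### Nearest neighbours on a one-dimensional grid. -/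

section Grid

/-- A point `m` steps to the right beats `i` exactly when `m * δ < t`, so the adjacent point gives
the weakest condition; likewise on the left. -/
lemma exists_grid_neighbour_iff {L : ℕ} (i : Fin L) {δ : ℝ} (hδ : 0 < δ) (t : ℝ) :
    (∃ j : Fin L, (2 * ((i : ℝ) - j) * δ) ^ 2 + 2 * (2 * ((i : ℝ) - j) * δ) * t < 0) ↔
      ((i : ℕ) + 1 < L ∧ δ < t) ∨ (0 < (i : ℕ) ∧ t < -δ) := by
  constructor
  · rintro ⟨j, hj⟩
    rcases lt_trichotomy (i : ℕ) j with h | h | h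
    · left
      refine ⟨by omega, ?_⟩
      have h1 : (i : ℝ) + 1 ≤ j := by exact_mod_cast h
      by_contra! ht
      nlinarith [mul_pos hδ hδ, mul_nonneg (sub_nonneg.2 h1) (sub_nonneg.2 ht),
        mul_nonneg (mul_nonneg (sub_nonneg.2 h1) (show (0 : ℝ) ≤ j - i by linarith)) (sq_nonneg δ),
        mul_nonneg (mul_nonneg (show (0 : ℝ) ≤ j - i by linarith) hδ.le) (sub_nonneg.2 ht)]
    · simp [h] at hj
    · right
      refine ⟨by omega, ?_⟩
      have h1 : (j : ℝ) + 1 ≤ i := by exact_mod_cast h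
      by_contra! ht
      nlinarith [mul_pos hδ hδ, mul_nonneg (sub_nonneg.2 h1) (sub_nonneg.2 ht),
        mul_nonneg (mul_nonneg (sub_nonneg.2 h1) (show (0 : ℝ) ≤ i - j by linarith)) (sq_nonneg δ),
        mul_nonneg (mul_nonneg (show (0 : ℝ) ≤ i - j by linarith) hδ.le) (sub_nonneg.2 ht)]
  · rintro (⟨h, ht⟩ | ⟨h, ht⟩)
    · refine ⟨⟨i + 1, h⟩, ?_⟩
      push_cast
      nlinarith
    · refine ⟨⟨i - 1, by omega⟩, ?_⟩
      push_cast [Nat.cast_sub (show 1 ≤ (i : ℕ) from h)]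
      nlinarith

lemma norm_add_sub_lt_norm_iff (a z b : ℂ) :
    ‖a + z - b‖ < ‖z‖ ↔ ((a.re - b.re) ^ 2 + 2 * (a.re - b.re) * z.re) +
      ((a.im - b.im) ^ 2 + 2 * (a.im - b.im) * z.im) < 0 := by
  rw [← sq_lt_sq₀ (norm_nonneg _) (norm_nonneg _), Complex.sq_norm, Complex.sq_norm,
    Complex.normSq_apply, Complex.normSq_apply]
  simp only [Complex.sub_re, Complex.add_re, Complex.sub_im, Complex.add_im]
  constructor <;> intro h <;> linarith

/-- The number of neighbours of `i` among `0, …, L - 1`. -/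
noncomputable def gridDegree {L : ℕ} (i : Fin L) : ℝ :=
  (if (i : ℕ) + 1 < L then 1 else 0) + (if 0 < (i : ℕ) then 1 else 0)

lemma sum_gridDegree {L : ℕ} (hL : 1 ≤ L) : ∑ i : Fin L, gridDegree i = 2 * ((L : ℝ) - 1) := by
  obtain ⟨n, rfl⟩ : ∃ n, L = n + 1 := ⟨L - 1, by omega⟩
  simp only [gridDegree, Finset.sum_add_distrib]
  rw [Fin.sum_univ_castSucc, Fin.sum_univ_succ (fun i : Fin (n + 1) =>
    if 0 < (i : ℕ) then (1 : ℝ) else 0)]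
  simp
  ring

/-- The propositions `P` and `Q` record whether a neighbour exists on each side, so interior and
boundary points are treated together. The two tails are disjoint because `0 < δ`. -/
lemma measureReal_two_sided {ρ : Measure ℂ} [IsFiniteMeasure ρ] {u : ℂ → ℝ} (hu : Measurable u)
    {R : Set ℂ} (hR : MeasurableSet R) {δ : ℝ} (hδ : 0 < δ) (P Q : Prop) [Decidable P]
    [Decidable Q] :
    ρ.real {z | ((P ∧ δ < u z) ∨ (Q ∧ u z < -δ)) ∧ z ∈ R} =
      (if P then 1 else 0) * ρ.real {z | δ < u z ∧ z ∈ R} +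
        (if Q then 1 else 0) * ρ.real {z | u z < -δ ∧ z ∈ R} := by
  have hm : MeasurableSet {z | u z < -δ ∧ z ∈ R} :=
    (measurableSet_lt hu measurable_const).inter hR
  by_cases hP : P <;> by_cases hQ : Q <;> simp only [hP, hQ, true_and, false_and, or_false,
    false_or, if_true, if_false, one_mul, zero_mul, add_zero, zero_add]
  · rw [← measureReal_union _ hm]
    · congr 1; ext z; simp only [Set.mem_ofPred_eq, Set.mem_union]; tauto
    · refine Set.disjoint_left.2 fun z h1 h2 => ?_
      linarith [h1.1, h2.1]
  · simp

end Grid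

/-! ### Error regions of the three constellations. -/

section Constellations

variable {τ : Measure ℝ}

lemma scaleMixture_real_preimage_isometry [SFinite τ] (e : ℂ ≃ₗᵢ[ℝ] ℂ) {E E' : Set ℂ}
    (hE : MeasurableSet E) (h : ∀ z, z ∈ E' ↔ e z ∈ E) :
    (scaleMixture τ).real E' = (scaleMixture τ).real E := by
  rw [measureReal_def, measureReal_def, ← scaleMixture_preimage_isometry e hE]
  congr 2
  ext z
  exact h z

/-- Multiplication by a complex number of norm one as a real linear isometry. -/
noncomputable def mulUnitLIE (a : ℂ) (ha : ‖a‖ = 1) : ℂ ≃ₗᵢ[ℝ] ℂ :=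
  rotation ⟨a, by simpa [Submonoid.unitSphere] using ha⟩

lemma mulUnitLIE_apply (a : ℂ) (ha : ‖a‖ = 1) (z : ℂ) : mulUnitLIE a ha z = a * z := rfl

lemma measureReal_pam_errorRegion [IsProbabilityMeasure τ] {M : ℕ} {δ : ℝ} (hδ : 0 < δ)
    (i : Fin M) :
    (scaleMixture τ).real (errorRegion
      (Set.range fun i : Fin M => (((2 * (i : ℝ) + 1 - M) * δ : ℝ) : ℂ))
      (((2 * (i : ℝ) + 1 - M) * δ : ℝ) : ℂ)) =
      gridDegree i * (scaleMixture τ).real {z | δ < z.re} := by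
  have hset : errorRegion (Set.range fun i : Fin M => (((2 * (i : ℝ) + 1 - M) * δ : ℝ) : ℂ))
      (((2 * (i : ℝ) + 1 - M) * δ : ℝ) : ℂ) =
      {z | (((i : ℕ) + 1 < M ∧ δ < z.re) ∨ (0 < (i : ℕ) ∧ z.re < -δ)) ∧ z ∈ Set.univ} := by
    ext z
    simp only [errorRegion, Set.mem_ofPred_eq, Set.exists_range_iff, norm_add_sub_lt_norm_iff,
      Complex.ofReal_re, Complex.ofReal_im, Set.mem_univ, and_true]
    rw [← exists_grid_neighbour_iff i hδ]
    refine exists_congr fun j => ?_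
    ring_nf
  have hneg : (scaleMixture τ).real {z | z.re < -δ ∧ z ∈ Set.univ} =
      (scaleMixture τ).real {z | δ < z.re} := by
    refine scaleMixture_real_preimage_isometry (LinearIsometryEquiv.neg ℝ)
      (measurableSet_lt measurable_const Complex.measurable_re) fun z => ?_
    simp [lt_neg]
  rw [hset, measureReal_two_sided Complex.measurable_re MeasurableSet.univ hδ, hneg, gridDegree]
  simp only [Set.mem_univ, and_true]
  ring

lemma measureReal_qam_errorRegion [IsProbabilityMeasure τ] {L : ℕ} {δ : ℝ} (hδ : 0 < δ)
    (p : Fin L × Fin L) :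
    (scaleMixture τ).real (errorRegion
      (Set.range fun p : Fin L × Fin L =>
        (⟨(2 * (p.1 : ℝ) + 1 - L) * δ, (2 * (p.2 : ℝ) + 1 - L) * δ⟩ : ℂ))
      ⟨(2 * (p.1 : ℝ) + 1 - L) * δ, (2 * (p.2 : ℝ) + 1 - L) * δ⟩) =
      (gridDegree p.1 + gridDegree p.2) * (scaleMixture τ).real {z | δ < z.re} -
        gridDegree p.1 * gridDegree p.2 * (scaleMixture τ).real {z | δ < z.re ∧ δ < z.im} := by
  obtain ⟨i, j⟩ := p
  let A : Set ℂ := {z | (((i : ℕ) + 1 < L ∧ δ < z.re) ∨ (0 < (i : ℕ) ∧ z.re < -δ))}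
  let B : Set ℂ := {z | (((j : ℕ) + 1 < L ∧ δ < z.im) ∨ (0 < (j : ℕ) ∧ z.im < -δ))}
  set ρ := scaleMixture τ with hρ
  have hre := Complex.measurable_re
  have him := Complex.measurable_im
  have hrp : MeasurableSet {z : ℂ | δ < z.re} := measurableSet_lt measurable_const hre
  have hrn : MeasurableSet {z : ℂ | z.re < -δ} := measurableSet_lt hre measurable_const
  have hip : MeasurableSet {z : ℂ | δ < z.im} := measurableSet_lt measurable_const him
  have hin : MeasurableSet {z : ℂ | z.im < -δ} := measurableSet_lt him measurable_const
  have hBm : MeasurableSet B :=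
    ((MeasurableSet.const _).inter hip).union ((MeasurableSet.const _).inter hin)
  have hset : errorRegion
      (Set.range fun p : Fin L × Fin L =>
        (⟨(2 * (p.1 : ℝ) + 1 - L) * δ, (2 * (p.2 : ℝ) + 1 - L) * δ⟩ : ℂ))
      ⟨(2 * (i : ℝ) + 1 - L) * δ, (2 * (j : ℝ) + 1 - L) * δ⟩ = A ∪ B := by
    ext z
    have hi (a b : Fin L) : (2 * (a : ℝ) + 1 - L) * δ - (2 * (b : ℝ) + 1 - L) * δ =
      2 * ((a : ℝ) - b) * δ := by ring
    simp only [errorRegion, Set.mem_ofPred_eq, Set.exists_range_iff, norm_add_sub_lt_norm_iff,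
      Set.mem_union, Prod.exists, hi, A, B]
    rw [← exists_grid_neighbour_iff i hδ, ← exists_grid_neighbour_iff j hδ]
    -- The comparison is a sum of a real-part and an imaginary-part term: if the sum is negative,
    -- one of them is, and conversely moving along one axis only makes the other term zero.
    constructor
    · rintro ⟨a, b, h⟩
      by_cases h1 : (2 * ((i : ℝ) - a) * δ) ^ 2 + 2 * (2 * ((i : ℝ) - a) * δ) * z.re < 0
      · exact Or.inl ⟨a, h1⟩
      · exact Or.inr ⟨b, by linarith⟩
    · rintro (⟨a, h⟩ | ⟨b, h⟩)
      · exact ⟨a, j, by simpa using h⟩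
      · exact ⟨i, b, by simpa using h⟩
  -- Negation, conjugation and a quarter turn identify all four tails and all four corners.
  -- Inclusion-exclusion on `A ∪ B` then needs just one half-plane and one quadrant.
  have eneg := fun {E E' : Set ℂ} => scaleMixture_real_preimage_isometry (τ := τ)
    (LinearIsometryEquiv.neg ℝ) (E := E) (E' := E')
  have econj := fun {E E' : Set ℂ} => scaleMixture_real_preimage_isometry (τ := τ)
    Complex.conjLIE (E := E) (E' := E')
  have eI := fun {E E' : Set ℂ} => scaleMixture_real_preimage_isometry (τ := τ)
    (mulUnitLIE (-Complex.I) (by simp)) (E := E) (E' := E')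
  have q1 : ρ.real {z | z.re < -δ ∧ z ∈ Set.univ} = ρ.real {z | δ < z.re} :=
    eneg hrp fun z => by simp [lt_neg]
  have q2 : ρ.real {z | δ < z.im ∧ z ∈ Set.univ} = ρ.real {z | δ < z.re} :=
    eI hrp fun z => by simp [mulUnitLIE_apply]
  have q3 : ρ.real {z | z.im < -δ ∧ z ∈ Set.univ} = ρ.real {z | δ < z.re} := by
    rw [← q2]
    exact eneg (hip.inter MeasurableSet.univ) fun z => by simp [lt_neg]
  have r1 : ρ.real {z | z.im < -δ ∧ z ∈ {z : ℂ | δ < z.re}} =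
      ρ.real {z | δ < z.re ∧ δ < z.im} :=
    econj (hrp.inter hip) fun z => by simp [lt_neg, and_comm]
  have r2 : ρ.real {z | z.im < -δ ∧ z ∈ {z : ℂ | z.re < -δ}} =
      ρ.real {z | δ < z.re ∧ δ < z.im} :=
    eneg (hrp.inter hip) fun z => by simp [lt_neg, and_comm]
  have r3 : ρ.real {z | δ < z.im ∧ z ∈ {z : ℂ | z.re < -δ}} =
      ρ.real {z | δ < z.re ∧ δ < z.im} := by
    rw [← r1]
    exact eneg (hin.inter hrp) fun z => by simp [lt_neg]
  have r4 : ρ.real {z | δ < z.im ∧ z ∈ {z : ℂ | δ < z.re}} =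
      ρ.real {z | δ < z.re ∧ δ < z.im} := by
    congr 1; ext z; exact and_comm
  have hA : ρ.real A = gridDegree i * ρ.real {z | δ < z.re} := by
    have := measureReal_two_sided (ρ := ρ) hre MeasurableSet.univ hδ ((i : ℕ) + 1 < L) (0 < (i : ℕ))
    rw [q1] at this
    simp only [Set.mem_univ, and_true] at this
    rw [gridDegree, add_mul]
    exact this
  have hB : ρ.real B = gridDegree j * ρ.real {z | δ < z.re} := by
    have := measureReal_two_sided (ρ := ρ) him MeasurableSet.univ hδ ((j : ℕ) + 1 < L) (0 < (j : ℕ))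
    rw [q2, q3] at this
    simp only [Set.mem_univ, and_true] at this
    rw [gridDegree, add_mul]
    exact this
  have hAB : ρ.real (A ∩ B) =
      gridDegree i * gridDegree j * ρ.real {z | δ < z.re ∧ δ < z.im} := by
    have h1 := measureReal_two_sided (ρ := ρ) hre hBm hδ ((i : ℕ) + 1 < L) (0 < (i : ℕ))
    have h2 : {z : ℂ | δ < z.re ∧ z ∈ B} = {z : ℂ | (((j : ℕ) + 1 < L ∧ δ < z.im) ∨
        (0 < (j : ℕ) ∧ z.im < -δ)) ∧ z ∈ {z : ℂ | δ < z.re}} := by ext z; exact and_comm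
    have h3 : {z : ℂ | z.re < -δ ∧ z ∈ B} = {z : ℂ | (((j : ℕ) + 1 < L ∧ δ < z.im) ∨
        (0 < (j : ℕ) ∧ z.im < -δ)) ∧ z ∈ {z : ℂ | z.re < -δ}} := by ext z; exact and_comm
    rw [h2, h3, measureReal_two_sided him hrp hδ, measureReal_two_sided him hrn hδ,
      r1, r2, r3, r4] at h1
    refine Eq.trans h1 ?_
    rw [gridDegree, gridDegree]
    ring
  have hunion := measureReal_union_add_inter (μ := ρ) (s := A) hBm
  rw [hset]
  rw [hA, hB, hAB] at hunion
  dsimp only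
  linarith

lemma range_pskConstellation {M : ℕ} (hM : M ≠ 0) :
    pskConstellation M = {w : ℂ | w ^ M = 1} := by
  have hprim := Complex.isPrimitiveRoot_exp M hM
  have hexp (i : ℕ) : Complex.exp (2 * Real.pi * Complex.I * i / M) =
      Complex.exp (2 * Real.pi * Complex.I / M) ^ i := by
    rw [← Complex.exp_nat_mul]; congr 1; ring
  ext w
  simp only [pskConstellation, Set.mem_range, Set.mem_ofPred_eq, hexp]
  constructor
  · rintro ⟨i, hi⟩
    rw [← hi, pow_right_comm, hprim.pow_eq_one, one_pow]
  · intro h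
    have : NeZero M := ⟨hM⟩
    obtain ⟨i, hi, h⟩ := hprim.eq_pow_of_pow_eq_one h
    exact ⟨⟨i, hi⟩, h⟩

lemma injective_psk {M : ℕ} (hM : M ≠ 0) : Function.Injective fun i : Fin M =>
    Complex.exp (2 * Real.pi * Complex.I * (i : ℕ) / M) := by
  have hprim := Complex.isPrimitiveRoot_exp M hM
  have hexp (i : ℕ) : Complex.exp (2 * Real.pi * Complex.I * i / M) =
      Complex.exp (2 * Real.pi * Complex.I / M) ^ i := by
    rw [← Complex.exp_nat_mul]; congr 1; ring
  intro i j hij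
  simp only [hexp] at hij
  exact Fin.ext (hprim.pow_inj i.2 j.2 hij)

lemma measurableSet_errorRegion {S : Set ℂ} (hS : S.Finite) (a : ℂ) :
    MeasurableSet (errorRegion S a) := by
  have : errorRegion S a = ⋃ b ∈ S, {z : ℂ | ‖a + z - b‖ < ‖z‖} := by
    ext z; simp [errorRegion]
  rw [this]
  exact hS.measurableSet_biUnion fun b _ => measurableSet_lt (by fun_prop) (by fun_prop)

lemma finite_pskConstellation (M : ℕ) : (pskConstellation M).Finite := Set.finite_range _

/-- Rotation by `a` permutes the roots of unity and preserves the noise law. -/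
lemma measureReal_psk_errorRegion_eq_one [IsProbabilityMeasure τ] {M : ℕ} (hM : M ≠ 0) {a : ℂ}
    (ha : a ∈ pskConstellation M) :
    (scaleMixture τ).real (errorRegion (pskConstellation M) a) =
      (scaleMixture τ).real (errorRegion (pskConstellation M) 1) := by
  have haM : a ^ M = 1 := by rwa [range_pskConstellation hM] at ha
  have hnorm : ‖a‖ = 1 := Complex.norm_eq_one_of_pow_eq_one haM hM
  have ha0 : a ≠ 0 := fun h => by simp [h] at hnorm
  symm
  refine scaleMixture_real_preimage_isometry (mulUnitLIE a hnorm)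
    (measurableSet_errorRegion (finite_pskConstellation M) a) fun z => ?_
  simp only [mulUnitLIE_apply, errorRegion, Set.mem_ofPred_eq, range_pskConstellation hM, norm_mul,
    hnorm, one_mul]
  constructor
  · rintro ⟨b, hb, h⟩
    refine ⟨a * b, by rw [mul_pow, haM, hb, one_mul], ?_⟩
    rwa [show a + a * z - a * b = a * (1 + z - b) by ring, norm_mul, hnorm, one_mul]
  · rintro ⟨b, hb, h⟩
    refine ⟨a⁻¹ * b, by rw [mul_pow, inv_pow, haM, hb, inv_one, one_mul], ?_⟩
    have : a + a * z - b = a * (1 + z - a⁻¹ * b) := by field_simp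
    rwa [this, norm_mul, hnorm, one_mul] at h

/-- Writing the competing point with angle `2β` lets the half-angle formulas factor out `sin β`. -/
lemma norm_one_add_sub_exp_lt_iff (z : ℂ) (β : ℝ) :
    ‖1 + z - Complex.exp (2 * β * Complex.I)‖ < ‖z‖ ↔
      0 < Real.sin β * ((z.im * Real.cos β - z.re * Real.sin β) - Real.sin β) := by
  have h : Complex.exp (2 * β * Complex.I) = Complex.exp ((2 * β : ℝ) * Complex.I) := by
    push_cast; rfl
  rw [norm_add_sub_lt_norm_iff, h, Complex.exp_ofReal_mul_I_re, Complex.exp_ofReal_mul_I_im,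
    Complex.one_re, Complex.one_im, Real.sin_two_mul, Real.cos_two_mul, Real.cos_sq']
  have h2 := Real.sin_sq_add_cos_sq β
  have h3 : (1 - (2 * (1 - Real.sin β ^ 2) - 1)) ^ 2 +
      2 * (1 - (2 * (1 - Real.sin β ^ 2) - 1)) * z.re +
      ((0 - 2 * Real.sin β * Real.cos β) ^ 2 + 2 * (0 - 2 * Real.sin β * Real.cos β) * z.im) =
      -4 * (Real.sin β * ((z.im * Real.cos β - z.re * Real.sin β) - Real.sin β)) := by
    linear_combination 4 * Real.sin β ^ 2 * h2
  rw [h3]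
  constructor <;> intro h <;> linarith

/-- In the upper half-plane only the neighbour `exp(2πi/M)` matters: an error towards any other
point implies one towards it. -/
lemma psk_errorRegion_inter_upper {M : ℕ} (hM : 2 ≤ M) :
    errorRegion (pskConstellation M) 1 ∩ {z | 0 < z.im} =
      starRegion (Set.Ioo (Real.pi / M) Real.pi) (fun φ => Real.sin (φ - Real.pi / M))
        (Real.sin (Real.pi / M)) := by
  have hpi := Real.pi_pos
  have hM0 : (0 : ℝ) < M := by positivity
  have hM2 : (2 : ℝ) ≤ M := by exact_mod_cast hM
  have hβ0 : 0 < Real.pi / M := by positivity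
  have hβ1 : Real.pi / M < Real.pi := div_lt_self hpi (by linarith)
  have hsin1 := Real.sin_pos_of_pos_of_lt_pi hβ0 hβ1
  have hexp (i : ℕ) : Complex.exp (2 * Real.pi * Complex.I * i / M) =
      Complex.exp (2 * (Real.pi * i / M : ℝ) * Complex.I) := by
    congr 1; push_cast; ring
  have hstar (z : ℂ) : ‖z‖ * Real.sin (z.arg - Real.pi / M) =
      z.im * Real.cos (Real.pi / M) - z.re * Real.sin (Real.pi / M) := by
    rw [Real.sin_sub, mul_sub, ← mul_assoc, ← mul_assoc, Complex.norm_mul_sin_arg,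
      Complex.norm_mul_cos_arg]
  ext z
  simp only [errorRegion, pskConstellation, Set.exists_range_iff, hexp,
    norm_one_add_sub_exp_lt_iff, Set.mem_inter_iff, Set.mem_ofPred_eq, starRegion, hstar]
  constructor
  · rintro ⟨⟨i, hi⟩, him⟩
    have hi0 : (i : ℕ) ≠ 0 := by
      intro h; simp [h] at hi
    have hi1 : (1 : ℝ) ≤ (i : ℕ) := by exact_mod_cast Nat.one_le_iff_ne_zero.2 hi0
    have hiM : ((i : ℕ) : ℝ) < M := by exact_mod_cast i.2
    set β := Real.pi * (i : ℕ) / M with hβ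
    have hle : Real.pi / M ≤ β := by
      rw [hβ]; gcongr; nlinarith
    have hlt : β < Real.pi := by
      rw [hβ, div_lt_iff₀ hM0]; nlinarith
    have hsin : 0 < Real.sin β := Real.sin_pos_of_pos_of_lt_pi (by linarith) hlt
    have hpos := (pos_iff_pos_of_mul_pos hi).1 hsin
    have hsub : 0 ≤ Real.sin (β - Real.pi / M) :=
      Real.sin_nonneg_of_nonneg_of_le_pi (by linarith) (by linarith)
    rw [Real.sin_sub] at hsub
    have hgoal : Real.sin (Real.pi / M) <
        z.im * Real.cos (Real.pi / M) - z.re * Real.sin (Real.pi / M) := by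
      have h1 : 0 < Real.sin β * (z.im * Real.cos (Real.pi / M) - z.re * Real.sin (Real.pi / M) -
          Real.sin (Real.pi / M)) := by
        -- The condition for `π/M`, scaled by `sin β`, is the condition for `β` scaled by `sin
        -- (π/M)`, plus `z.im * sin (β - π/M) ≥ 0`.
        have : Real.sin β * (z.im * Real.cos (Real.pi / M) - z.re * Real.sin (Real.pi / M) -
          Real.sin (Real.pi / M)) = Real.sin (Real.pi / M) *
            (z.im * Real.cos β - z.re * Real.sin β - Real.sin β) +
            z.im * (Real.sin β * Real.cos (Real.pi / M) - Real.cos β * Real.sin (Real.pi / M)) := by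
          ring
        rw [this]
        exact add_pos_of_pos_of_nonneg (mul_pos hsin1 hpos) (mul_nonneg him.le hsub)
      linarith [(pos_iff_pos_of_mul_pos h1).1 hsin]
    refine ⟨⟨?_, ?_⟩, hgoal⟩
    · by_contra! hle
      have h2 : Real.sin (z.arg - Real.pi / M) ≤ 0 :=
        Real.sin_nonpos_of_nonpos_of_neg_pi_le (by linarith)
          (by linarith [Complex.arg_nonneg_iff.2 him.le])
      have := hstar z
      nlinarith [norm_nonneg z]
    · refine lt_of_le_of_ne (Complex.arg_le_pi z) fun h => ?_
      have := (Complex.arg_eq_pi_iff.1 h).2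
      linarith
  · rintro ⟨⟨h1, h2⟩, h3⟩
    refine ⟨⟨⟨1, by omega⟩, ?_⟩, ?_⟩
    · simp only [Nat.cast_one, mul_one]
      exact mul_pos hsin1 (by linarith)
    · rw [← Complex.norm_mul_sin_arg]
      refine mul_pos (norm_pos_iff.2 ?_) (Real.sin_pos_of_pos_of_lt_pi (by linarith) h2)
      rintro rfl
      simp at h1
      linarith

lemma mem_psk_errorRegion_conj {M : ℕ} (hM : M ≠ 0) (z : ℂ) :
    conj z ∈ errorRegion (pskConstellation M) 1 ↔ z ∈ errorRegion (pskConstellation M) 1 := by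
  have key (w : ℂ) (h : w ∈ errorRegion (pskConstellation M) 1) :
      conj w ∈ errorRegion (pskConstellation M) 1 := by
    rw [range_pskConstellation hM] at h ⊢
    obtain ⟨b, hb, h⟩ := h
    refine ⟨conj b, by
      rw [Set.mem_ofPred_eq] at hb ⊢
      rw [← map_pow, hb, map_one], ?_⟩
    have h1 : 1 + conj w - conj b = conj (1 + w - b) := by simp
    rwa [h1, Complex.norm_conj, Complex.norm_conj]
  exact ⟨fun h => by simpa using key _ h, key z⟩

/-- The real axis is null and conjugation exchanges the two half-planes, so the upper sector counts
twice. Shifting the angle by `π/M` gives the upper limit `(M - 1)π/M`. -/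
lemma measureReal_psk_errorRegion [IsProbabilityMeasure τ] {Nr Nt M : ℕ} {η x : ℝ} (hN : Nt ≤ Nr)
    (hη : 0 ≤ η) (hx : 0 < x) (hτ : ∀ᵐ r ∂τ, 0 < r)
    (hL : ∀ t : ℝ, 0 ≤ t → ∫⁻ r, ENNReal.ofReal (Real.exp (-(t / r ^ 2))) ∂τ =
      ENNReal.ofReal ((1 + t * (η / x))⁻¹ ^ (Nr - Nt + 1))) (hM : 2 ≤ M) :
    (scaleMixture τ).real (errorRegion (pskConstellation M) 1) = pskG Nr Nt M η x := by
  have hpi := Real.pi_pos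
  have hM0 : (0 : ℝ) < M := by positivity
  have hM2 : (2 : ℝ) ≤ M := by exact_mod_cast hM
  have hβ0 : 0 < Real.pi / M := by positivity
  have hβ1 : Real.pi / M < Real.pi := div_lt_self hpi (by linarith)
  set ρ := scaleMixture τ with hρ
  set E := errorRegion (pskConstellation M) 1 with hE
  have hEm : MeasurableSet E := measurableSet_errorRegion (finite_pskConstellation M) 1
  have hup : MeasurableSet {z : ℂ | 0 < z.im} :=
    measurableSet_lt measurable_const Complex.measurable_im
  have hlow : MeasurableSet {z : ℂ | z.im < 0} :=
    measurableSet_lt Complex.measurable_im measurable_const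
  have hreal : ρ {z : ℂ | z.im = 0} = 0 := by
    refine scaleMixture_absolutelyContinuous hτ ?_
    have h := Measure.addHaar_submodule (volume : Measure ℂ) (LinearMap.ker Complex.imLm) (by
      intro h
      have : Complex.I ∈ LinearMap.ker Complex.imLm := h ▸ Submodule.mem_top
      simp at this)
    convert h using 2
    ext z; simp
  have hlower : ρ.real (E ∩ {z | z.im < 0}) = ρ.real (E ∩ {z | 0 < z.im}) :=
    scaleMixture_real_preimage_isometry Complex.conjLIE (hEm.inter hup) fun z => by
      simp only [Set.mem_inter_iff, Set.mem_ofPred_eq, Complex.conjLIE_apply, hE,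
        mem_psk_errorRegion_conj (show M ≠ 0 by omega), Complex.conj_im, Left.neg_pos_iff]
  have hae : E =ᵐ[ρ] ((E ∩ {z | 0 < z.im}) ∪ (E ∩ {z | z.im < 0}) : Set ℂ) := by
    filter_upwards [measure_eq_zero_iff_ae_notMem.1 hreal] with z hz
    refine propext ⟨fun h => ?_, ?_⟩
    · rcases lt_or_gt_of_ne hz with h1 | h1
      · exact Or.inr ⟨h, h1⟩
      · exact Or.inl ⟨h, h1⟩
    · rintro (h | h)
      · exact h.1
      · exact h.1
  rw [measureReal_congr hae, measureReal_union _ (hEm.inter hlow), hlower, hE,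
    psk_errorRegion_inter_upper hM]
  · rw [scaleMixture_starRegion measurableSet_Ioo (Set.Ioo_subset_Ioo (by linarith) le_rfl)
      (by fun_prop) (fun φ hφ => Real.sin_pos_of_pos_of_lt_pi (by linarith [hφ.1])
        (by linarith [hφ.2])) (Real.sin_pos_of_pos_of_lt_pi hβ0 hβ1).le hτ
      (div_nonneg hη hx.le) hL]
    simp_rw [craigIntegrand_sin hN]
    rw [← integral_Ioc_eq_integral_Ioo, ← intervalIntegral.integral_of_le hβ1.le,
      intervalIntegral.integral_const_mul,
      intervalIntegral.integral_comp_sub_right (craigIntegrand Nr Nt _ x), sub_self, pskG,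
      show Real.pi - Real.pi / M = ((M : ℝ) - 1) * Real.pi / M by field_simp,
      mul_comm (Real.sin (Real.pi / M) ^ 2) η, mul_inv]
    ring
  · refine Set.disjoint_left.2 fun z h1 h2 => ?_
    have h3 : z.im < 0 := h2.2
    have h4 : 0 < z.im := h1.2
    linarith

end Constellations

/-! ### Convexity below the threshold. -/

section Convexity

/-- The second derivative is a nonnegative factor times `(k + 1) * a - 2 * x`. Here `k + 2` plays
the role of `D`, so `k + 1` is `Nr - Nt`. -/
lemma convexOn_div_add_pow {a T : ℝ} (ha : 0 < a) (k : ℕ) (hT : 2 * T ≤ (k + 1) * a) :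
    ConvexOn ℝ (Set.Ioc 0 T) fun x : ℝ => (x / (x + a)) ^ (k + 2) := by
  have hderiv (x : ℝ) (hx : 0 < x) : HasDerivAt (fun x : ℝ => x / (x + a)) (a / (x + a) ^ 2) x := by
    have h := (hasDerivAt_id x).div ((hasDerivAt_id x).add_const a) (by simp; linarith)
    refine h.congr_deriv ?_
    simp
  have hpow (x : ℝ) (hx : 0 < x) (n : ℕ) : HasDerivAt (fun x : ℝ => (x / (x + a)) ^ (n + 1))
      ((n + 1) * (x / (x + a)) ^ n * (a / (x + a) ^ 2)) x := by
    have h := (hderiv x hx).pow (n + 1)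
    refine h.congr_deriv ?_
    simp
  have hsq (x : ℝ) (hx : 0 < x) :
      HasDerivAt (fun x : ℝ => a / (x + a) ^ 2) (-(2 * a) / (x + a) ^ 3) x := by
    have hne : x + a ≠ 0 := by linarith
    have h := (hasDerivAt_const x a).div (((hasDerivAt_id x).add_const a).pow 2)
      (by simp; linarith)
    refine h.congr_deriv ?_
    simp
    field_simp
  refine convexOn_of_hasDerivWithinAt2_nonneg (convex_Ioc 0 T)
    (f' := fun x => ((k + 1 : ℕ) + 1 : ℝ) * (x / (x + a)) ^ (k + 1) * (a / (x + a) ^ 2))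
    (f'' := fun x => ((k + 1 : ℕ) + 1 : ℝ) * ((k + 1) * (x / (x + a)) ^ k * (a / (x + a) ^ 2)) *
      (a / (x + a) ^ 2) + ((k + 1 : ℕ) + 1 : ℝ) * (x / (x + a)) ^ (k + 1) *
        (-(2 * a) / (x + a) ^ 3)) ?_ ?_ ?_ ?_
  · exact fun x hx => ((hpow x hx.1 (k + 1)).continuousAt).continuousWithinAt
  · intro x hx
    rw [interior_Ioc] at hx
    exact (hpow x hx.1 (k + 1)).hasDerivWithinAt
  · intro x hx
    rw [interior_Ioc] at hx
    exact (((hpow x hx.1 k).const_mul _).mul (hsq x hx.1)).hasDerivWithinAt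
  · intro x hx
    rw [interior_Ioc] at hx
    have hx0 := hx.1
    have hne : x + a ≠ 0 := by linarith
    have heq : ((k + 1 : ℕ) + 1 : ℝ) * ((k + 1) * (x / (x + a)) ^ k * (a / (x + a) ^ 2)) *
      (a / (x + a) ^ 2) + ((k + 1 : ℕ) + 1 : ℝ) * (x / (x + a)) ^ (k + 1) *
        (-(2 * a) / (x + a) ^ 3) =
        ((k + 1 : ℕ) + 1 : ℝ) * (x / (x + a)) ^ k * (a / (x + a) ^ 4) * ((k + 1) * a - 2 * x) := by
      rw [pow_succ (x / (x + a)) k]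
      field_simp
      ring
    rw [heq]
    have h1 : 0 ≤ (k + 1) * a - 2 * x := by linarith [hx.2]
    positivity

variable {Nr Nt : ℕ}

lemma convexOn_craigIntegrand (hN : Nt ≤ Nr) {c : ℝ} (hc : 0 < c) (θ : ℝ) :
    ConvexOn ℝ (Set.Ioc 0 (((Nr : ℝ) - Nt) * c / 2)) fun x => craigIntegrand Nr Nt c x θ := by
  -- For `Nr = Nt` the threshold is `0` and the interval is empty.
  rcases hN.eq_or_lt with rfl | hlt
  · rw [sub_self, zero_mul, zero_div, Set.Ioc_self]
    exact ⟨convex_empty, by simp⟩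
  obtain ⟨k, rfl⟩ : ∃ k, Nr = Nt + (k + 1) := ⟨Nr - Nt - 1, by omega⟩
  -- Division by zero gives `0`, so the integrand is the constant `1` at such `θ`.
  by_cases hs : Real.sin θ = 0
  · simp only [craigIntegrand, hs]
    norm_num
    exact convexOn_const _ (convex_Ioc _ _)
  have hs2 : 0 < Real.sin θ ^ 2 := by positivity
  have ha : 0 < c / Real.sin θ ^ 2 := by positivity
  -- The threshold is tightest at `sin² θ = 1`, so a single interval serves every `θ`.
  have hca : c ≤ c / Real.sin θ ^ 2 := le_div_self hc.le hs2 (Real.sin_sq_le_one θ)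
  have h := convexOn_div_add_pow (T := (((Nt + (k + 1) : ℕ) : ℝ) - Nt) * c / 2) ha k (by
    push_cast
    nlinarith [mul_le_mul_of_nonneg_left hca (show (0 : ℝ) ≤ k + 1 by positivity)])
  refine h.congr fun x hx => ?_
  have hx0 := hx.1
  rw [craigIntegrand_eq hN, show Nt + (k + 1) - Nt + 1 = k + 2 by omega]
  field_simp

lemma convexOn_integral_craigIntegrand (hN : Nt ≤ Nr) {c : ℝ} (hc : 0 < c) {p q : ℝ}
    (hpq : p ≤ q) :
    ConvexOn ℝ (Set.Ioc 0 (((Nr : ℝ) - Nt) * c / 2)) fun x =>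
      ∫ θ in p..q, craigIntegrand Nr Nt c x θ := by
  refine ⟨convex_Ioc _ _, fun x hx y hy α β hα hβ hαβ => ?_⟩
  have hi (x : ℝ) (hx : 0 ≤ x) := intervalIntegrable_craigIntegrand hN hc.le hx p q
  have hxy : 0 ≤ α • x + β • y := by
    have := hx.1; have := hy.1
    simp only [smul_eq_mul]; positivity
  simp only [smul_eq_mul] at hxy ⊢
  rw [← intervalIntegral.integral_const_mul, ← intervalIntegral.integral_const_mul,
    ← intervalIntegral.integral_add ((hi x hx.1.le).const_mul α) ((hi y hy.1.le).const_mul β)]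
  refine intervalIntegral.integral_mono_on hpq (hi _ hxy)
    (((hi x hx.1.le).const_mul α).add ((hi y hy.1.le).const_mul β)) fun θ _ => ?_
  exact (convexOn_craigIntegrand hN hc θ).2 hx hy hα hβ hαβ

lemma convexOn_pamG (hN : Nt ≤ Nr) {η : ℝ} (hη : 0 < η) {M : ℕ} (hM : 2 ≤ M) :
    ConvexOn ℝ (Set.Ioc 0 (pamThreshold Nr Nt M η)) (pamG Nr Nt M η) := by
  have hM2 : (2 : ℝ) ≤ M := by exact_mod_cast hM
  have hM1 : (0 : ℝ) < (M : ℝ) ^ 2 - 1 := by nlinarith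
  have h := convexOn_integral_craigIntegrand hN (c := 3 * η / ((M : ℝ) ^ 2 - 1)) (by positivity)
    (p := 0) (q := Real.pi / 2) (by positivity)
  have hT : pamThreshold Nr Nt M η = ((Nr : ℝ) - Nt) * (3 * η / ((M : ℝ) ^ 2 - 1)) / 2 := by
    rw [pamThreshold]; field_simp
  rw [hT]
  exact h.smul (div_nonneg (mul_nonneg zero_le_two (by linarith)) (by positivity))

lemma convexOn_pskG (hN : Nt ≤ Nr) {η : ℝ} (hη : 0 < η) {M : ℕ} (hM : 2 ≤ M) :
    ConvexOn ℝ (Set.Ioc 0 (pskThreshold Nr Nt M η)) (pskG Nr Nt M η) := by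
  have hM2 : (2 : ℝ) ≤ M := by exact_mod_cast hM
  have hpi := Real.pi_pos
  have hsin : 0 < Real.sin (Real.pi / M) :=
    Real.sin_pos_of_pos_of_lt_pi (by positivity) (div_lt_self hpi (by linarith))
  have h := convexOn_integral_craigIntegrand hN (c := η * Real.sin (Real.pi / M) ^ 2)
    (by positivity) (p := 0) (q := ((M : ℝ) - 1) * Real.pi / M)
    (div_nonneg (mul_nonneg (by linarith) hpi.le) (by positivity))
  have hT : pskThreshold Nr Nt M η =
      ((Nr : ℝ) - Nt) * (η * Real.sin (Real.pi / M) ^ 2) / 2 := by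
    rw [pskThreshold]; ring
  rw [hT]
  exact h.smul (by positivity)

lemma convexOn_qamG (hN : Nt ≤ Nr) {η : ℝ} (hη : 0 < η) {M : ℕ} (hM : 2 ≤ M) :
    ConvexOn ℝ (Set.Ioc 0 (qamThreshold Nr Nt M η)) (qamG Nr Nt M η) := by
  have hM2 : (2 : ℝ) ≤ M := by exact_mod_cast hM
  have hM1 : (0 : ℝ) < (M : ℝ) - 1 := by linarith
  have hpi := Real.pi_pos
  have hsqrt : 0 ≤ √(M : ℝ) - 1 := sub_nonneg.2 (Real.one_le_sqrt.2 (by linarith))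
  have h1 := convexOn_integral_craigIntegrand hN (c := 3 * η / (2 * ((M : ℝ) - 1)))
    (by positivity) (p := Real.pi / 4) (q := Real.pi / 2) (by linarith)
  have h2 := convexOn_integral_craigIntegrand hN (c := 3 * η / (2 * ((M : ℝ) - 1)))
    (by positivity) (p := 0) (q := Real.pi / 4) (by linarith)
  have hT : qamThreshold Nr Nt M η =
      ((Nr : ℝ) - Nt) * (3 * η / (2 * ((M : ℝ) - 1))) / 2 := by
    rw [qamThreshold]; field_simp; ring
  rw [hT]
  exact (h1.smul (c := 4 * (√(M : ℝ) - 1) / (√(M : ℝ) * Real.pi)) (by positivity)).add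
    (h2.smul (c := 4 * (√(M : ℝ) - 1) / (M * Real.pi)) (by positivity))

end Convexity

/-! ### Averaging over each constellation. -/

section ErrorProbability

variable {Ω : Type*} [MeasurableSpace Ω] {μ : Measure Ω} [IsProbabilityMeasure μ]
  {Nr Nt : ℕ} {F Sig : Matrix (Fin Nt) (Fin Nt) ℂ} {σ η : ℝ}
  {H : Ω → Matrix (Fin Nr) (Fin Nt) ℂ} {ξ : Ω → Fin Nr → ℂ} {s sHat : Ω → Fin Nt → ℂ}

/-- The mean number of neighbours, `2(M - 1)/M`, is the prefactor of the half-plane probability. -/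
lemma pam_symbolErrorProb (hNt : 1 ≤ Nt) (hN : Nt ≤ Nr) (hF : IsUnit F) (hSig : Sig.PosDef)
    (hσ : 0 < σ) (hη : η = 1 / σ ^ 2) {M : ℕ} (hM : 2 ≤ M)
    (hsys : IsZFSystem μ (pamConstellation M) F Sig σ H ξ s sHat) (k : Fin Nt) :
    μ.real {ω | sHat ω k ≠ s ω k} = pamG Nr Nt M η (((Fᴴ * Sig * F)⁻¹ k k).re) := by
  have hM2 : (2 : ℝ) ≤ M := by exact_mod_cast hM
  have hM1 : (0 : ℝ) < (M : ℝ) ^ 2 - 1 := by nlinarith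
  have hη0 : 0 < η := by rw [hη]; positivity
  set δ := √(3 / ((M : ℝ) ^ 2 - 1)) with hδdef
  have hδ : 0 < δ := Real.sqrt_pos.2 (by positivity)
  have hδ2 : δ ^ 2 * η = 3 * η / ((M : ℝ) ^ 2 - 1) := by
    rw [hδdef, Real.sq_sqrt (by positivity)]; ring
  have hinj : Function.Injective fun i : Fin M => (((2 * (i : ℝ) + 1 - M) * δ : ℝ) : ℂ) := by
    intro i j hij
    have h1 := mul_right_cancel₀ hδ.ne' (Complex.ofReal_injective hij)
    have h2 : ((i : ℕ) : ℝ) = (j : ℕ) := by linarith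
    exact Fin.ext (by exact_mod_cast h2)
  have hx := (channel_gram_inv hNt hN hF hSig hsys.channel k).1
  obtain ⟨τ, hτ, hpos, hL, hP⟩ := exists_symbolErrorProb_eq hNt hN hF hSig hσ hinj hsys k
  rw [← hη] at hL
  rw [hP]
  simp_rw [measureReal_pam_errorRegion hδ]
  rw [← Finset.sum_mul, sum_gridDegree (by omega),
    scaleMixture_halfPlane hN hη0.le hx hpos hL hδ, hδ2, pamG, Fintype.card_fin]
  ring

lemma psk_symbolErrorProb (hNt : 1 ≤ Nt) (hN : Nt ≤ Nr) (hF : IsUnit F) (hSig : Sig.PosDef)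
    (hσ : 0 < σ) (hη : η = 1 / σ ^ 2) {M : ℕ} (hM : 2 ≤ M)
    (hsys : IsZFSystem μ (pskConstellation M) F Sig σ H ξ s sHat) (k : Fin Nt) :
    μ.real {ω | sHat ω k ≠ s ω k} = pskG Nr Nt M η (((Fᴴ * Sig * F)⁻¹ k k).re) := by
  have hM0 : M ≠ 0 := by omega
  have hη0 : 0 < η := by rw [hη]; positivity
  have hx := (channel_gram_inv hNt hN hF hSig hsys.channel k).1
  obtain ⟨τ, hτ, hpos, hL, hP⟩ :=
    exists_symbolErrorProb_eq hNt hN hF hSig hσ (injective_psk hM0) hsys k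
  rw [← hη] at hL
  have hterm (i : Fin M) : (scaleMixture τ).real (errorRegion (pskConstellation M)
      (Complex.exp (2 * Real.pi * Complex.I * (i : ℕ) / M))) =
      pskG Nr Nt M η (((Fᴴ * Sig * F)⁻¹ k k).re) := by
    rw [measureReal_psk_errorRegion_eq_one hM0 ⟨i, rfl⟩,
      measureReal_psk_errorRegion hN hη0.le hx hpos hL hM]
  refine hP.trans ((congrArg _ (Finset.sum_congr rfl fun i _ => hterm i)).trans ?_)
  rw [Finset.sum_const, Finset.card_univ,
    Fintype.card_fin, nsmul_eq_mul, inv_mul_cancel_left₀ (by exact_mod_cast hM0)]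

/-- Averaging gives `4(L - 1)/L` half-planes minus `4(L - 1)²/L²` quadrants. Splitting the
half-plane integral at `π/4` leaves the coefficient `4(L - 1)/L²` on `[0, π/4]`, where `L² = M`. -/
lemma qam_symbolErrorProb (hNt : 1 ≤ Nt) (hN : Nt ≤ Nr) (hF : IsUnit F) (hSig : Sig.PosDef)
    (hσ : 0 < σ) (hη : η = 1 / σ ^ 2) {L : ℕ} (hL2 : 2 ≤ L)
    (hsys : IsZFSystem μ (qamConstellation L) F Sig σ H ξ s sHat) (k : Fin Nt) :
    μ.real {ω | sHat ω k ≠ s ω k} = qamG Nr Nt (L ^ 2) η (((Fᴴ * Sig * F)⁻¹ k k).re) := by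
  have hL2' : (2 : ℝ) ≤ L := by exact_mod_cast hL2
  have hM1 : (0 : ℝ) < (L : ℝ) ^ 2 - 1 := by nlinarith
  have hη0 : 0 < η := by rw [hη]; positivity
  set δ := √(3 / (2 * ((L : ℝ) ^ 2 - 1))) with hδdef
  have hδ : 0 < δ := Real.sqrt_pos.2 (by positivity)
  have hδ2 : δ ^ 2 * η = 3 * η / (2 * ((L : ℝ) ^ 2 - 1)) := by
    rw [hδdef, Real.sq_sqrt (by positivity)]; ring
  have hinj : Function.Injective fun p : Fin L × Fin L =>
      (⟨(2 * (p.1 : ℝ) + 1 - L) * δ, (2 * (p.2 : ℝ) + 1 - L) * δ⟩ : ℂ) := by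
    intro p q hpq
    have h1 := mul_right_cancel₀ hδ.ne' (congrArg Complex.re hpq)
    have h2 := mul_right_cancel₀ hδ.ne' (congrArg Complex.im hpq)
    have h3 : ((p.1 : ℕ) : ℝ) = (q.1 : ℕ) := by linarith
    have h4 : ((p.2 : ℕ) : ℝ) = (q.2 : ℕ) := by linarith
    exact Prod.ext (Fin.ext (by exact_mod_cast h3)) (Fin.ext (by exact_mod_cast h4))
  have hx := (channel_gram_inv hNt hN hF hSig hsys.channel k).1
  obtain ⟨τ, hτ, hpos, hL, hP⟩ := exists_symbolErrorProb_eq hNt hN hF hSig hσ hinj hsys k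
  rw [← hη] at hL
  rw [hP]
  simp_rw [measureReal_qam_errorRegion hδ]
  have hc : 0 ≤ 3 * η / (2 * ((L : ℝ) ^ 2 - 1)) := by positivity
  have hi := intervalIntegrable_craigIntegrand hN hc hx.le
  have hs : ∑ i : Fin L, gridDegree i = 2 * ((L : ℝ) - 1) := sum_gridDegree (by omega)
  rw [Finset.sum_sub_distrib, ← Finset.sum_mul, ← Finset.sum_mul, Fintype.sum_prod_type,
    Fintype.sum_prod_type]
  simp_rw [Finset.sum_add_distrib, ← Finset.mul_sum, Finset.sum_const, hs]
  rw [← Finset.sum_mul, ← Finset.smul_sum, hs, scaleMixture_halfPlane hN hη0.le hx hpos hL hδ,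
    scaleMixture_quadrant hN hη0.le hx hpos hL hδ, hδ2, qamG, Fintype.card_prod, Fintype.card_fin,
    ← intervalIntegral.integral_add_adjacent_intervals (hi 0 (Real.pi / 4))
      (hi (Real.pi / 4) (Real.pi / 2))]
  push_cast
  rw [Real.sqrt_sq (by linarith)]
  simp only [Finset.card_univ, Fintype.card_fin, nsmul_eq_mul]
  have hL0 : (L : ℝ) ≠ 0 := by linarith
  field_simp
  ring

end ErrorProbability

theorem lemma1 {Ω : Type*} [MeasurableSpace Ω] (μ : Measure Ω) [IsProbabilityMeasure μ]
    (Nr Nt : ℕ) (hNt : 1 ≤ Nt) (hN : Nt ≤ Nr)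
    (F Sig : Matrix (Fin Nt) (Fin Nt) ℂ) (hF : IsUnit F) (hSig : Sig.PosDef)
    (σ η : ℝ) (hσ : 0 < σ) (hη : η = 1 / σ ^ 2)
    (H : Ω → Matrix (Fin Nr) (Fin Nt) ℂ) (ξ : Ω → Fin Nr → ℂ) (s sHat : Ω → Fin Nt → ℂ) :
    (∀ M : ℕ, 2 ≤ M →
      (IsZFSystem μ (pamConstellation M) F Sig σ H ξ s sHat →
        averageSEP μ s sHat =
          (1 / (Nt : ℝ)) * ∑ k, pamG Nr Nt M η (((Fᴴ * Sig * F)⁻¹ k k).re)) ∧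
      ConvexOn ℝ (Set.Ioc 0 (pamThreshold Nr Nt M η)) (pamG Nr Nt M η)) ∧
    (∀ M : ℕ, 2 ≤ M →
      (IsZFSystem μ (pskConstellation M) F Sig σ H ξ s sHat →
        averageSEP μ s sHat =
          (1 / (Nt : ℝ)) * ∑ k, pskG Nr Nt M η (((Fᴴ * Sig * F)⁻¹ k k).re)) ∧
      ConvexOn ℝ (Set.Ioc 0 (pskThreshold Nr Nt M η)) (pskG Nr Nt M η)) ∧
    (∀ L M : ℕ, 2 ≤ L → M = L ^ 2 →
      (IsZFSystem μ (qamConstellation L) F Sig σ H ξ s sHat →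
        averageSEP μ s sHat =
          (1 / (Nt : ℝ)) * ∑ k, qamG Nr Nt M η (((Fᴴ * Sig * F)⁻¹ k k).re)) ∧
      ConvexOn ℝ (Set.Ioc 0 (qamThreshold Nr Nt M η)) (qamG Nr Nt M η)) := by

  have hη0 : 0 < η := by rw [hη]; positivity
  refine ⟨fun M hM => ⟨fun hsys => ?_, convexOn_pamG hN hη0 hM⟩,
    fun M hM => ⟨fun hsys => ?_, convexOn_pskG hN hη0 hM⟩, ?_⟩
  · rw [averageSEP, Finset.sum_congr rfl fun k _ =>
      pam_symbolErrorProb hNt hN hF hSig hσ hη hM hsys k]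
  · rw [averageSEP, Finset.sum_congr rfl fun k _ =>
      psk_symbolErrorProb hNt hN hF hSig hσ hη hM hsys k]
  · rintro L M hL rfl
    refine ⟨fun hsys => ?_, convexOn_qamG hN hη0 (by nlinarith)⟩
    rw [averageSEP, Finset.sum_congr rfl fun k _ =>
      qam_symbolErrorProb hNt hN hF hSig hσ hη hL hsys k]
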